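/- Let $(\bar M^{2m+1},\phi,\xi,\eta,g)$ be a Kenmotsu manifold: an almost contact metric manifold, i.e. $\phi\xi=0$, $\eta\circ\phi=0$, $\phi^2=-I+\eta\otimes\xi$, $g(\phi X,Y)=-g(X,\phi Y)$, $\eta=g(\cdot,\xi)$, $\eta(\xi)=1$, $g(\phi X,\phi Y)=g(X,Y)-\eta(X)\eta(Y)$, whose Riemannian connection $\bar\nabla$ satisfies $\bar\nabla_X\xi=X-\eta(X)\xi$ and $(\bar\nabla_X\phi)Y=g(\phi X,Y)\xi-\eta(Y)\phi X$. For an immersed submanifold $M$ of $\bar M$ with $\xi$ tangent to $M$, write $\phi X=PX+QX$ for $X$ tangent to $M$, with $PX$ tangent and $QX$ normal to $M$, and let $h$ be the second fundamental form, i.e. $h(X,Y)$ is the normal component of $\bar\nabla_XY$. Put $\mathcal D^T=\ker(P^2+I)$, $\mathcal D^\perp=\{X\in\ker P: X\perp\xi\}$ and $\mathcal D^\theta=\ker(P^2+\cos^2\theta\, I)$ for a constant $\theta\in(0,\pi/2)$. $M$ is a skew CR-submanifold of order $1$ (with slant angle $\theta$) if $TM=\mathcal D^T\oplus\mathcal D^\perp\oplus\mathcal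 D^\theta\oplus\langle\xi\rangle$ with distributions of constant rank (rank $0$ is allowed). Let $\nu$ be the orthogonal complement of $\phi\mathcal D^\perp\oplus Q\mathcal D^\theta$ in the normal bundle $T^\perp M$. Let $M=M_2\times_fM_T$ be a warped product skew CR-submanifold of order $1$ of $\bar M$, where $M_2=M_\perp\times M_\theta$ as a manifold. That is: $M_\perp,M_\theta,M_T$ are manifolds, $g_2$ is a Riemannian metric on $M_2$, $g_T$ is a Riemannian metric on $M_T$, $f$ is a positive smooth function on $M_2$, the manifold $M=M_2\times M_T$ with the metric $g_2+f^2g_T$ is isometrically immersed in $\bar M$ as a skew CR-submanifold of order $1$ with slant angle $\theta$, $\xi$ is tangent to $M_2$, and $TM_T=\mathcal D^T$, $\mathcal D^\perp\subseteq TM_\perp\subseteq\mathcal D^\perp\oplus\langle\xi\rangle$, $\mathcal D^\theta\subseteq TM_\theta\subseteq\mathcal D^\theta\oplus\langle\xi\rangle$. Then $\nu$ is $\phi$-invariant, and $h(X,E)\in\nu$ for every $X$ tangent to $M_T$ and every $E$ tangent to $M_2$. -/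

import Mathlib

open Bundle Manifold
open scoped ContDiff InnerProductSpace

noncomputable section

namespace SkewCR

section Ambient

variable {E : Type*} [NormedAddCommGroup E] [NormedSpace ℝ E] [FiniteDimensional ℝ E]
  {H : Type*} [TopologicalSpace H] (I : ModelWithCorners ℝ E H)
  (N : Type*) [TopologicalSpace N] [ChartedSpace H N] [IsManifold I ∞ N]
  [RiemannianBundle (fun x : N ↦ TangentSpace I x)]

/-- An almost contact metric structure `(φ, ξ, η, g)` on a manifold `N` with Riemannian metric `g`
(the inner product of the tangent spaces). Smoothness of `η` is automatic, as `η = g(·, ξ)`. -/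
structure AlmostContactMetric where
  /-- The `(1,1)` tensor field. -/
  φ : Π x : N, TangentSpace I x →L[ℝ] TangentSpace I x
  /-- The structure vector field. -/
  ξ : Π x : N, TangentSpace I x
  /-- The structure one-form. -/
  η : Π x : N, TangentSpace I x →L[ℝ] ℝ
  contMDiff_φ : ContMDiff I (I.prod 𝓘(ℝ, E →L[ℝ] E)) ∞
    (fun x ↦ TotalSpace.mk' (E →L[ℝ] E)
      (E := fun x : N ↦ TangentSpace I x →L[ℝ] TangentSpace I x) x (φ x))
  contMDiff_ξ : ContMDiff I I.tangent ∞ (fun x ↦ (⟨x, ξ x⟩ : TangentBundle I N))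
  φ_ξ : ∀ x, φ x (ξ x) = 0
  η_φ : ∀ x v, η x (φ x v) = 0
  φ_φ : ∀ x v, φ x (φ x v) = -v + η x v • ξ x
  inner_φ_left : ∀ x v w, ⟪φ x v, w⟫_ℝ = -⟪v, φ x w⟫_ℝ
  η_eq : ∀ x v, η x v = ⟪v, ξ x⟫_ℝ
  η_ξ : ∀ x, η x (ξ x) = 1
  inner_φ_φ : ∀ x v w, ⟪φ x v, φ x w⟫_ℝ = ⟪v, w⟫_ℝ - η x v * η x w

variable {I N}

/-- `cov` is the Riemannian (Levi-Civita) connection: it is metric and torsion-free. As usual for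
Mathlib's covariant derivatives, `cov Y x v` is `∇_v Y` at `x`, and it is only meaningful for
fields `Y` that are differentiable at `x`; on those these two properties determine it. -/
structure IsLeviCivita (cov : CovariantDerivative I E (TangentSpace I : N → Type _)) : Prop where
  metric : ∀ (x : N) (v : TangentSpace I x) (Y Z : Π y : N, TangentSpace I y),
    MDifferentiableAt I I.tangent (fun y ↦ (⟨y, Y y⟩ : TangentBundle I N)) x →
    MDifferentiableAt I I.tangent (fun y ↦ (⟨y, Z y⟩ : TangentBundle I N)) x →
    mvfderiv I (fun y ↦ ⟪Y y, Z y⟫_ℝ) x v = ⟪cov Y x v, Z x⟫_ℝ + ⟪Y x, cov Z x v⟫_ℝ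
  torsion_free : cov.torsion = 0

/-- The almost contact metric structure `S` is a Kenmotsu structure, where `cov` is the Riemannian
connection: `∇_v ξ = v - η(v) ξ` and `(∇_v φ) Y = g(φ v, Y) ξ - η(Y) φ v`, where
`(∇_v φ) Y = ∇_v (φ Y) - φ (∇_v Y)`. -/
structure IsKenmotsu (S : AlmostContactMetric I N)
    (cov : CovariantDerivative I E (TangentSpace I : N → Type _)) : Prop where
  isLeviCivita : IsLeviCivita cov
  cov_ξ : ∀ (x : N) (v : TangentSpace I x), cov S.ξ x v = v - S.η x v • S.ξ x
  cov_φ : ∀ (x : N) (v : TangentSpace I x) (Y : Π y : N, TangentSpace I y),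
    MDifferentiableAt I I.tangent (fun y ↦ (⟨y, Y y⟩ : TangentBundle I N)) x →
    cov (fun y ↦ S.φ y (Y y)) x v - S.φ x (cov Y x v)
      = ⟪S.φ x v, Y x⟫_ℝ • S.ξ x - S.η x (Y x) • S.φ x v

end Ambient

section Submanifold

variable {E : Type*} [NormedAddCommGroup E] [NormedSpace ℝ E] [FiniteDimensional ℝ E]
  {H : Type*} [TopologicalSpace H] {I : ModelWithCorners ℝ E H}
  {N : Type*} [TopologicalSpace N] [ChartedSpace H N] [IsManifold I ∞ N]
  [RiemannianBundle (fun x : N ↦ TangentSpace I x)]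
  {E' : Type*} [NormedAddCommGroup E'] [NormedSpace ℝ E'] [FiniteDimensional ℝ E']
  {H' : Type*} [TopologicalSpace H'] (J : ModelWithCorners ℝ E' H')
  {M : Type*} [TopologicalSpace M] [ChartedSpace H' M]

instance (x : N) : FiniteDimensional ℝ (TangentSpace I x) :=
  inferInstanceAs (FiniteDimensional ℝ E)

variable (I) in
/-- The tangent space `T_pM` of the immersed submanifold `ι : M → N`, inside `T_{ι p} N`. -/
def tangent (ι : M → N) (p : M) : Submodule ℝ (TangentSpace I (ι p)) :=
  (mfderiv J I ι p).range

variable (I) in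
/-- The normal space `T_p^⊥ M` of the immersed submanifold `ι : M → N`. -/
def normal (ι : M → N) (p : M) : Submodule ℝ (TangentSpace I (ι p)) :=
  (tangent I J ι p)ᗮ

/-- `P v`, the tangential component of `φ v`. -/
def P (S : AlmostContactMetric I N) (ι : M → N) (p : M) :
    TangentSpace I (ι p) →L[ℝ] TangentSpace I (ι p) :=
  (tangent I J ι p).starProjection ∘L S.φ (ι p)

/-- `Q v`, the normal component of `φ v`. -/
def Q (S : AlmostContactMetric I N) (ι : M → N) (p : M) :
    TangentSpace I (ι p) →L[ℝ] TangentSpace I (ι p) :=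
  (normal I J ι p).starProjection ∘L S.φ (ι p)

/-- `𝒟^c`, the kernel of `P² + c² I` on `T_pM`. -/
def eigenDist (S : AlmostContactMetric I N) (ι : M → N) (c : ℝ) (p : M) :
    Submodule ℝ (TangentSpace I (ι p)) :=
  tangent I J ι p ⊓
    (P J S ι p ∘L P J S ι p + c ^ 2 • ContinuousLinearMap.id ℝ (TangentSpace I (ι p))).ker

/-- The line spanned by `ξ`. -/
def xiLine (S : AlmostContactMetric I N) (ι : M → N) (p : M) :
    Submodule ℝ (TangentSpace I (ι p)) :=
  Submodule.span ℝ {S.ξ (ι p)}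

/-- The invariant distribution `𝒟^T`. It is orthogonal to `ξ`, because `P ξ = 0`. -/
def distT (S : AlmostContactMetric I N) (ι : M → N) (p : M) :
    Submodule ℝ (TangentSpace I (ι p)) :=
  eigenDist J S ι 1 p

/-- The anti-invariant distribution `𝒟^⊥`: the part of `𝒟^0 = ker P` orthogonal to `ξ`. -/
def distPerp (S : AlmostContactMetric I N) (ι : M → N) (p : M) :
    Submodule ℝ (TangentSpace I (ι p)) :=
  eigenDist J S ι 0 p ⊓ (xiLine S ι p)ᗮ

/-- The slant distribution `𝒟^θ`, the eigenspace of `P²` for the eigenvalue `-cos² θ`. -/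
def distSlant (S : AlmostContactMetric I N) (ι : M → N) (θ : ℝ) (p : M) :
    Submodule ℝ (TangentSpace I (ι p)) :=
  eigenDist J S ι (Real.cos θ) p

/-- `ι : M → N` is a proper skew CR-submanifold of order `1`, tangent to `ξ`, whose only eigenvalue
of `P²` besides `0` and `-1` is the constant `-λ₁² = -cos² θ`, with `λ₁ = cos θ ∈ (0, 1)`:
`TM = 𝒟^T ⊕ 𝒟^⊥ ⊕ 𝒟^θ ⊕ ⟨ξ⟩`. The sum is automatically direct and orthogonal, as these are
eigenspaces of the symmetric operator `P²`, the last one orthogonal to `𝒟^⊥` in `ker P`.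
Each of the distributions is allowed to vanish. -/
structure IsSkewCROrderOne (S : AlmostContactMetric I N) (ι : M → N) (θ : ℝ) : Prop where
  θ_mem : θ ∈ Set.Ioo 0 (Real.pi / 2)
  ξ_mem : ∀ p, S.ξ (ι p) ∈ tangent I J ι p
  decomp : ∀ p, distT J S ι p ⊔ distPerp J S ι p ⊔ distSlant J S ι θ p ⊔ xiLine S ι p
    = tangent I J ι p
  rank_T : ∀ p q, Module.finrank ℝ (distT J S ι p) = Module.finrank ℝ (distT J S ι q)
  rank_perp : ∀ p q, Module.finrank ℝ (distPerp J S ι p) = Module.finrank ℝ (distPerp J S ι q)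
  rank_slant : ∀ p q,
    Module.finrank ℝ (distSlant J S ι θ p) = Module.finrank ℝ (distSlant J S ι θ q)

/-- The normal subbundle `ν`: the orthogonal complement of `φ 𝒟^⊥ ⊕ Q 𝒟^θ` in `T^⊥ M`. -/
def nu (S : AlmostContactMetric I N) (ι : M → N) (θ : ℝ) (p : M) :
    Submodule ℝ (TangentSpace I (ι p)) :=
  normal I J ι p ⊓
    ((distPerp J S ι p).map (S.φ (ι p)).toLinearMap ⊔
      (distSlant J S ι θ p).map (Q J S ι p).toLinearMap)ᗮ

/-- The covariant derivative `∇_v W` at `p`, for `v ∈ T_pM`, of a vector field `W` along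
`ι : M → N`. If `W = ∑ Wⁱ eᵢ ∘ ι` in the local frame `eᵢ` of `TN` given by the preferred
trivialization at `ι p`, then it is `∑ (dWⁱ v) eᵢ + ∑ Wⁱ ∇_{dι v} eᵢ`: the first sum is the first
summand below, and the second one is the derivative of the local field `∑ Wⁱ(p) eᵢ`, which is
`FiberBundle.extend E (W p)`. -/
def covAlong (cov : CovariantDerivative I E (TangentSpace I : N → Type _)) (ι : M → N)
    (W : Π q : M, TangentSpace I (ι q)) (p : M) (v : TangentSpace J p) : TangentSpace I (ι p) :=
  (trivializationAt E (TangentSpace I : N → Type _) (ι p)).symmL ℝ (ι p)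
      (mvfderiv J
        (fun q ↦ ((trivializationAt E (TangentSpace I : N → Type _) (ι p))
          (⟨ι q, W q⟩ : TangentBundle I N)).2) p v)
    + cov (FiberBundle.extend E (W p)) (ι p) (mfderiv J I ι p v)

/-- The second fundamental form `h(X, Y)` at `p` of the immersed submanifold `ι : M → N`, for
vector fields `X`, `Y` on `M`: the normal component of `∇_X (dι Y)`. -/
def secondFF (cov : CovariantDerivative I E (TangentSpace I : N → Type _)) (ι : M → N)
    (X Y : Π q : M, TangentSpace J q) (p : M) : TangentSpace I (ι p) :=
  (normal I J ι p).starProjection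
    (covAlong J cov ι (fun q ↦ mfderiv J I ι q (Y q)) p (X p))

end Submanifold

section Warped

variable {E : Type*} [NormedAddCommGroup E] [NormedSpace ℝ E] [FiniteDimensional ℝ E]
  {H : Type*} [TopologicalSpace H] {I : ModelWithCorners ℝ E H}
  {N : Type*} [TopologicalSpace N] [ChartedSpace H N] [IsManifold I ∞ N]
  [RiemannianBundle (fun x : N ↦ TangentSpace I x)]

section TwoFactors

variable {E₁ : Type*} [NormedAddCommGroup E₁] [NormedSpace ℝ E₁]
  {H₁ : Type*} [TopologicalSpace H₁] (J₁ : ModelWithCorners ℝ E₁ H₁)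
  {M₁ : Type*} [TopologicalSpace M₁] [ChartedSpace H₁ M₁] [IsManifold J₁ ∞ M₁]
  {E₂ : Type*} [NormedAddCommGroup E₂] [NormedSpace ℝ E₂]
  {H₂ : Type*} [TopologicalSpace H₂] (J₂ : ModelWithCorners ℝ E₂ H₂)
  {M₂ : Type*} [TopologicalSpace M₂] [ChartedSpace H₂ M₂] [IsManifold J₂ ∞ M₂]

/-- The immersion `ι : M₁ × M₂ → N` is isometric for the warped product metric `g₁ + f² g₂`, with
smooth warping function `f > 0` on `M₁`. (So `ι` is an immersion.) -/
structure IsWarpedProductImmersion (ι : M₁ × M₂ → N)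
    (g₁ : ContMDiffRiemannianMetric J₁ ∞ E₁ (fun x : M₁ ↦ TangentSpace J₁ x))
    (g₂ : ContMDiffRiemannianMetric J₂ ∞ E₂ (fun x : M₂ ↦ TangentSpace J₂ x))
    (f : M₁ → ℝ) : Prop where
  contMDiff_f : ContMDiff J₁ 𝓘(ℝ, ℝ) ∞ f
  f_pos : ∀ x, 0 < f x
  contMDiff_ι : ContMDiff (J₁.prod J₂) I ∞ ι
  isometric : ∀ (p : M₁ × M₂) (v w : TangentSpace (J₁.prod J₂) p),
    ⟪mfderiv (J₁.prod J₂) I ι p v, mfderiv (J₁.prod J₂) I ι p w⟫_ℝ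
      = g₁.inner p.1 (mfderiv (J₁.prod J₂) J₁ Prod.fst p v)
          (mfderiv (J₁.prod J₂) J₁ Prod.fst p w)
        + f p.1 ^ 2 * g₂.inner p.2 (mfderiv (J₁.prod J₂) J₂ Prod.snd p v)
          (mfderiv (J₁.prod J₂) J₂ Prod.snd p w)

/-- The vectors of `T_p(M₁ × M₂)` that are tangent to the first factor. -/
def tangentFst (p : M₁ × M₂) : Submodule ℝ (TangentSpace (J₁.prod J₂) p) :=
  (mfderiv (J₁.prod J₂) J₂ Prod.snd p).ker

/-- The vectors of `T_p(M₁ × M₂)` that are tangent to the second factor. -/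
def tangentSnd (p : M₁ × M₂) : Submodule ℝ (TangentSpace (J₁.prod J₂) p) :=
  (mfderiv (J₁.prod J₂) J₁ Prod.fst p).ker

end TwoFactors

variable {EA : Type*} [NormedAddCommGroup EA] [NormedSpace ℝ EA] [FiniteDimensional ℝ EA]
  {HA : Type*} [TopologicalSpace HA] (JA : ModelWithCorners ℝ EA HA)
  {A : Type*} [TopologicalSpace A] [ChartedSpace HA A] [IsManifold JA ∞ A]
  {EB : Type*} [NormedAddCommGroup EB] [NormedSpace ℝ EB] [FiniteDimensional ℝ EB]
  {HB : Type*} [TopologicalSpace HB] (JB : ModelWithCorners ℝ EB HB)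
  {B : Type*} [TopologicalSpace B] [ChartedSpace HB B] [IsManifold JB ∞ B]
  {EC : Type*} [NormedAddCommGroup EC] [NormedSpace ℝ EC] [FiniteDimensional ℝ EC]
  {HC : Type*} [TopologicalSpace HC] (JC : ModelWithCorners ℝ EC HC)
  {C : Type*} [TopologicalSpace C] [ChartedSpace HC C] [IsManifold JC ∞ C]

/-- The vectors of `T_p((A × B) × C)` that are tangent to the factor `A`. -/
def tangentA (p : (A × B) × C) : Submodule ℝ (TangentSpace ((JA.prod JB).prod JC) p) :=
  (mfderiv ((JA.prod JB).prod JC) (JB.prod JC)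
    (fun q : (A × B) × C ↦ (q.1.2, q.2)) p).ker

/-- The vectors of `T_p((A × B) × C)` that are tangent to the factor `B`. -/
def tangentB (p : (A × B) × C) : Submodule ℝ (TangentSpace ((JA.prod JB).prod JC) p) :=
  (mfderiv ((JA.prod JB).prod JC) (JA.prod JC)
    (fun q : (A × B) × C ↦ (q.1.1, q.2)) p).ker

/-- `ι : (A × B) × C → N` is a warped product skew CR-submanifold `M₂ ×_f M_T` of order `1`, where
`M₂ = M_⊥ × M_θ`, `M_⊥ = A`, `M_θ = B`, `M_T = C`, with `ξ` tangent to `M₂`.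

The product `M₂ = M_⊥ × M_θ` is one of manifolds: its metric `g₂` is arbitrary. The factors `M_T`,
`M_⊥`, `M_θ` are integral manifolds of `𝒟^T`, `𝒟^⊥`, `𝒟^θ`, up to the direction `ξ`, which is
tangent either to `M_⊥` or to `M_θ`. So `M_T` is invariant, `M_⊥` anti-invariant, and `M_θ` proper
slant with slant angle `θ`. -/
structure IsWarpedSkewCR (S : AlmostContactMetric I N) (ι : (A × B) × C → N)
    (g₂ : ContMDiffRiemannianMetric (JA.prod JB) ∞ (EA × EB)
      (fun x : A × B ↦ TangentSpace (JA.prod JB) x))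
    (gT : ContMDiffRiemannianMetric JC ∞ EC (fun x : C ↦ TangentSpace JC x))
    (f : A × B → ℝ) (θ : ℝ) : Prop where
  warped : IsWarpedProductImmersion (I := I) (JA.prod JB) JC ι g₂ gT f
  skewCR : IsSkewCROrderOne ((JA.prod JB).prod JC) S ι θ
  ξ_tangent : ∀ p, S.ξ (ι p) ∈ (tangentFst (JA.prod JB) JC p).map
    (mfderiv ((JA.prod JB).prod JC) I ι p).toLinearMap
  invariant : ∀ p, (tangentSnd (JA.prod JB) JC p).map
    (mfderiv ((JA.prod JB).prod JC) I ι p).toLinearMap = distT ((JA.prod JB).prod JC) S ι p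
  le_antiInvariant : ∀ p, distPerp ((JA.prod JB).prod JC) S ι p ≤
    (tangentA JA JB JC p).map (mfderiv ((JA.prod JB).prod JC) I ι p).toLinearMap
  antiInvariant_le : ∀ p,
    (tangentA JA JB JC p).map (mfderiv ((JA.prod JB).prod JC) I ι p).toLinearMap
      ≤ distPerp ((JA.prod JB).prod JC) S ι p ⊔ xiLine S ι p
  le_slant : ∀ p, distSlant ((JA.prod JB).prod JC) S ι θ p ≤
    (tangentB JA JB JC p).map (mfderiv ((JA.prod JB).prod JC) I ι p).toLinearMap
  slant_le : ∀ p,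
    (tangentB JA JB JC p).map (mfderiv ((JA.prod JB).prod JC) I ι p).toLinearMap
      ≤ distSlant ((JA.prod JB).prod JC) S ι θ p ⊔ xiLine S ι p

end Warped

end SkewCR

end

noncomputable section

namespace SkewCR

open Filter Topology

section Along

variable {E : Type*} [NormedAddCommGroup E] [NormedSpace ℝ E]
  {H : Type*} [TopologicalSpace H] {I : ModelWithCorners ℝ E H}
  {N : Type*} [TopologicalSpace N] [ChartedSpace H N] [IsManifold I ∞ N]
  {E' : Type*} [NormedAddCommGroup E'] [NormedSpace ℝ E']
  {H' : Type*} [TopologicalSpace H'] {J : ModelWithCorners ℝ E' H'}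
  {M : Type*} [TopologicalSpace M] [ChartedSpace H' M]
  {ι : M → N} {p : M}

/-- The coordinates of a vector field along `ι` in the preferred trivialization at `ι p`. -/
def coordsAlong (I : ModelWithCorners ℝ E H) [IsManifold I ∞ N] (ι : M → N)
    (W : Π q : M, TangentSpace I (ι q)) (p : M) (q : M) : E :=
  ((trivializationAt E (TangentSpace I : N → Type _) (ι p))
    (⟨ι q, W q⟩ : TangentBundle I N)).2

variable (J) in
/-- Differentiability at `p` of a vector field along `ι`. -/
def DiffAlongAt (ι : M → N) (W : Π q : M, TangentSpace I (ι q)) (p : M) : Prop :=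
  MDifferentiableAt J I.tangent (fun q ↦ (⟨ι q, W q⟩ : TangentBundle I N)) p

theorem diffAlongAt_iff {W : Π q : M, TangentSpace I (ι q)} :
    DiffAlongAt J ι W p ↔
      MDifferentiableAt J I ι p ∧ MDifferentiableAt J 𝓘(ℝ, E) (coordsAlong I ι W p) p :=
  mdifferentiableAt_totalSpace _ _

theorem DiffAlongAt.mdifferentiableAt {W : Π q : M, TangentSpace I (ι q)}
    (hW : DiffAlongAt J ι W p) : MDifferentiableAt J I ι p :=
  (diffAlongAt_iff.1 hW).1

theorem DiffAlongAt.coordsAlong {W : Π q : M, TangentSpace I (ι q)}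
    (hW : DiffAlongAt J ι W p) : MDifferentiableAt J 𝓘(ℝ, E) (coordsAlong I ι W p) p :=
  (diffAlongAt_iff.1 hW).2

theorem eventually_mem_baseSet (hι : ContinuousAt ι p) :
    ∀ᶠ q in 𝓝 p, ι q ∈ (trivializationAt E (TangentSpace I : N → Type _) (ι p)).baseSet :=
  hι ((trivializationAt E (TangentSpace I : N → Type _) (ι p)).open_baseSet.mem_nhds
    (FiberBundle.mem_baseSet_trivializationAt' _))

theorem coordsAlong_apply {W : Π q : M, TangentSpace I (ι q)} {q : M}
    (hq : ι q ∈ (trivializationAt E (TangentSpace I : N → Type _) (ι p)).baseSet) :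
    coordsAlong I ι W p q =
      (trivializationAt E (TangentSpace I : N → Type _) (ι p)).continuousLinearMapAt ℝ (ι q)
        (W q) := by
  rw [Trivialization.continuousLinearMapAt_apply, Trivialization.coe_linearMapAt_of_mem _ hq]
  rfl

theorem symmL_coordsAlong {W : Π q : M, TangentSpace I (ι q)} {q : M}
    (hq : ι q ∈ (trivializationAt E (TangentSpace I : N → Type _) (ι p)).baseSet) :
    (trivializationAt E (TangentSpace I : N → Type _) (ι p)).symmL ℝ (ι q)
      (coordsAlong I ι W p q) = W q := by
  rw [coordsAlong_apply hq, Trivialization.symmL_continuousLinearMapAt _ hq]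

theorem coordsAlong_add (hι : ContinuousAt ι p) (W V : Π q : M, TangentSpace I (ι q)) :
    coordsAlong I ι (fun q ↦ W q + V q) p =ᶠ[𝓝 p] coordsAlong I ι W p + coordsAlong I ι V p := by
  filter_upwards [eventually_mem_baseSet (I := I) hι] with q hq
  simp only [Pi.add_apply, coordsAlong_apply hq, map_add]

theorem coordsAlong_smul (hι : ContinuousAt ι p) (g : M → ℝ) (W : Π q : M, TangentSpace I (ι q)) :
    coordsAlong I ι (fun q ↦ g q • W q) p =ᶠ[𝓝 p] g • coordsAlong I ι W p := by
  filter_upwards [eventually_mem_baseSet (I := I) hι] with q hq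
  simp only [Pi.smul_apply', coordsAlong_apply hq, map_smul]

theorem DiffAlongAt.add {W V : Π q : M, TangentSpace I (ι q)} (hW : DiffAlongAt J ι W p)
    (hV : DiffAlongAt J ι V p) : DiffAlongAt J ι (fun q ↦ W q + V q) p :=
  diffAlongAt_iff.2 ⟨hW.mdifferentiableAt, (hW.coordsAlong.add hV.coordsAlong).congr_of_eventuallyEq
    (coordsAlong_add hW.mdifferentiableAt.continuousAt W V)⟩

theorem DiffAlongAt.smul {g : M → ℝ} {W : Π q : M, TangentSpace I (ι q)}
    (hg : MDifferentiableAt J 𝓘(ℝ, ℝ) g p) (hW : DiffAlongAt J ι W p) :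
    DiffAlongAt J ι (fun q ↦ g q • W q) p :=
  diffAlongAt_iff.2 ⟨hW.mdifferentiableAt, (hg.smul hW.coordsAlong).congr_of_eventuallyEq
    (coordsAlong_smul hW.mdifferentiableAt.continuousAt g W)⟩

theorem DiffAlongAt.comp (hι : MDifferentiableAt J I ι p) {Z : Π y : N, TangentSpace I y}
    (hZ : MDifferentiableAt I I.tangent (fun y ↦ (⟨y, Z y⟩ : TangentBundle I N)) (ι p)) :
    DiffAlongAt J ι (fun q ↦ Z (ι q)) p :=
  MDifferentiableAt.comp p hZ hι

/-- An operation on vector fields along `ι` is tensorial at `p`. -/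
structure TensorialAlong (J : ModelWithCorners ℝ E' H') (ι : M → N) (p : M)
    {A : Type*} [AddCommGroup A] [Module ℝ A]
    (Φ : (Π q : M, TangentSpace I (ι q)) → A) : Prop where
  smul : ∀ {g : M → ℝ} {W : Π q : M, TangentSpace I (ι q)}, MDifferentiableAt J 𝓘(ℝ, ℝ) g p →
    DiffAlongAt J ι W p → Φ (fun q ↦ g q • W q) = g p • Φ W
  add : ∀ {W V : Π q : M, TangentSpace I (ι q)}, DiffAlongAt J ι W p → DiffAlongAt J ι V p →
    Φ (fun q ↦ W q + V q) = Φ W + Φ V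

namespace TensorialAlong

variable {A : Type*} [AddCommGroup A] [Module ℝ A] {Φ : (Π q : M, TangentSpace I (ι q)) → A}

theorem congr (hΦ : TensorialAlong J ι p Φ) {W V : Π q : M, TangentSpace I (ι q)}
    (hW : DiffAlongAt J ι W p) (hV : DiffAlongAt J ι V p) (hWV : ∀ᶠ q in 𝓝 p, W q = V q) :
    Φ W = Φ V := by
  classical
  let ψ (q : M) : ℝ := if W q = V q then 1 else 0
  have hψp : ψ p = 1 := by simp [ψ, hWV.self_of_nhds]
  have h : (fun q ↦ ψ q • W q) = fun q ↦ ψ q • V q := by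
    funext q
    dsimp [ψ]
    split_ifs with hq <;> simp [hq]
  have hψ : MDifferentiableAt J 𝓘(ℝ, ℝ) ψ p :=
    (mdifferentiableAt_const (c := (1 : ℝ))).congr_of_eventuallyEq
      (hWV.mono fun q hq ↦ by simp [ψ, hq])
  calc Φ W = Φ (fun q ↦ ψ q • W q) := by rw [hΦ.smul hψ hW, hψp, one_smul]
    _ = Φ V := by rw [h, hΦ.smul hψ hV, hψp, one_smul]

theorem zero (hΦ : TensorialAlong J ι p Φ) (hι : MDifferentiableAt J I ι p) :
    Φ (fun _ ↦ 0) = 0 := by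
  have h0 : DiffAlongAt J ι (fun q ↦ (0 : TangentSpace I (ι q))) p :=
    DiffAlongAt.comp hι (Z := fun _ ↦ 0) (mdifferentiableAt_zeroSection ..)
  simpa using hΦ.smul (g := fun _ ↦ (0 : ℝ)) mdifferentiableAt_const h0

theorem sum (hΦ : TensorialAlong J ι p Φ) (hι : MDifferentiableAt J I ι p) {κ : Type*}
    (s : Finset κ) (W : κ → Π q : M, TangentSpace I (ι q)) (hW : ∀ i, DiffAlongAt J ι (W i) p) :
    DiffAlongAt J ι (fun q ↦ ∑ i ∈ s, W i q) p ∧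
      Φ (fun q ↦ ∑ i ∈ s, W i q) = ∑ i ∈ s, Φ (W i) := by
  classical
  induction s using Finset.induction_on with
  | empty =>
    simp only [Finset.sum_empty]
    exact ⟨DiffAlongAt.comp hι (Z := fun _ ↦ 0) (mdifferentiableAt_zeroSection ..), hΦ.zero hι⟩
  | insert a s ha h =>
    simp only [Finset.sum_insert ha]
    exact ⟨(hW a).add h.1, by rw [hΦ.add (hW a) h.1, h.2]⟩

variable [FiniteDimensional ℝ E]

theorem eq_zero_of_apply_eq_zero (hΦ : TensorialAlong J ι p Φ)
    {W : Π q : M, TangentSpace I (ι q)} (hW : DiffAlongAt J ι W p) (h0 : W p = 0) : Φ W = 0 := by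
  have hι := hW.mdifferentiableAt
  let e := trivializationAt E (TangentSpace I : N → Type _) (ι p)
  let b := Module.finBasis ℝ E
  let c (i) : E →L[ℝ] ℝ := (b.coord i).toContinuousLinearMap
  let s (i) : Π q : M, TangentSpace I (ι q) :=
    fun q ↦ FiberBundle.extend E (e.symmL ℝ (ι p) (b i)) (ι q)
  have hs (i) : DiffAlongAt J ι (s i) p := DiffAlongAt.comp hι (FiberBundle.mdifferentiableAt_extend ..)
  have hc (i) : MDifferentiableAt J 𝓘(ℝ, ℝ) (fun q ↦ c i (coordsAlong I ι W p q)) p :=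
    (c i).differentiableAt.comp_mdifferentiableAt hW.coordsAlong
  have hsum := hΦ.sum hι Finset.univ (fun i q ↦ c i (coordsAlong I ι W p q) • s i q)
    fun i ↦ (hs i).smul (hc i)
  have hp := FiberBundle.mem_baseSet_trivializationAt' (F := E) (E := TangentSpace I) (ι p)
  rw [hΦ.congr hW hsum.1 ?_, hsum.2]
  · refine Finset.sum_eq_zero fun i _ ↦ ?_
    rw [hΦ.smul (hc i) (hs i), coordsAlong_apply hp, h0, map_zero, map_zero, zero_smul]
  · filter_upwards [eventually_mem_baseSet (I := I) hι.continuousAt] with q hq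
    have hsq (i) : s i q = e.symmL ℝ (ι q) (b i) := by
      have : (e ⟨ι p, e.symmL ℝ (ι p) (b i)⟩).2 = b i := by
        rw [Trivialization.symmL_apply _ hp, Trivialization.apply_mk_symm _ hp]
      simp only [s, FiberBundle.extend]
      rw [this, Trivialization.symmL_apply _ hq]
    simp only [hsq, ← map_smul, ← map_sum]
    conv_lhs => rw [← symmL_coordsAlong (W := W) hq]
    congr 1
    exact (b.sum_repr _).symm

/-- A tensorial operation depends only on the value at the point. -/
theorem apply_eq (hΦ : TensorialAlong J ι p Φ)
    {W : Π q : M, TangentSpace I (ι q)} (hW : DiffAlongAt J ι W p) :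
    Φ W = Φ (fun q ↦ FiberBundle.extend E (W p) (ι q)) := by
  have hE : DiffAlongAt J ι (fun q ↦ FiberBundle.extend E (W p) (ι q)) p :=
    DiffAlongAt.comp hW.mdifferentiableAt (FiberBundle.mdifferentiableAt_extend ..)
  have hE' := hE.smul (g := fun _ ↦ (-1 : ℝ)) mdifferentiableAt_const
  have h := hΦ.eq_zero_of_apply_eq_zero (hW.add hE') (by simp)
  rw [hΦ.add hW hE', hΦ.smul mdifferentiableAt_const hE] at h
  rwa [neg_one_smul, add_neg_eq_zero] at h

end TensorialAlong

end Along

section CovAlong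

variable {E : Type*} [NormedAddCommGroup E] [NormedSpace ℝ E]
  {H : Type*} [TopologicalSpace H] {I : ModelWithCorners ℝ E H}
  {N : Type*} [TopologicalSpace N] [ChartedSpace H N] [IsManifold I ∞ N]
  {E' : Type*} [NormedAddCommGroup E'] [NormedSpace ℝ E']
  {H' : Type*} [TopologicalSpace H'] {J : ModelWithCorners ℝ E' H'}
  {M : Type*} [TopologicalSpace M] [ChartedSpace H' M]
  {ι : M → N} {p : M} (cov : CovariantDerivative I E (TangentSpace I : N → Type _))

theorem extend_eq_symmL {x y : N} (v : TangentSpace I x)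
    (hy : y ∈ (trivializationAt E (TangentSpace I : N → Type _) x).baseSet) :
    FiberBundle.extend E v y =
      (trivializationAt E (TangentSpace I : N → Type _) x).symmL ℝ y
        ((trivializationAt E (TangentSpace I : N → Type _) x).continuousLinearMapAt ℝ x v) := by
  have hx := FiberBundle.mem_baseSet_trivializationAt' (F := E) (E := TangentSpace I) x
  rw [Trivialization.continuousLinearMapAt_apply, Trivialization.coe_linearMapAt_of_mem _ hx,
    Trivialization.symmL_apply _ hy]
  rfl

theorem coordsAlong_extend {x : N} (hι : ContinuousAt ι p) (hx : ι p = x) (v : TangentSpace I x) :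
    ∀ᶠ q in 𝓝 p, coordsAlong I ι (fun q ↦ FiberBundle.extend E v (ι q)) p q =
      (trivializationAt E (TangentSpace I : N → Type _) x).continuousLinearMapAt ℝ x v := by
  subst hx
  filter_upwards [eventually_mem_baseSet (I := I) hι] with q hq
  rw [coordsAlong_apply hq, extend_eq_symmL v hq, Trivialization.continuousLinearMapAt_symmL _ hq]

theorem cov_extend_add {x : N} (v w : TangentSpace I x) :
    cov (FiberBundle.extend E (v + w)) x =
      cov (FiberBundle.extend E v) x + cov (FiberBundle.extend E w) x := by
  rw [← cov.isCovariantDerivativeOn.add (FiberBundle.mdifferentiableAt_extend ..)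
    (FiberBundle.mdifferentiableAt_extend ..) (Set.mem_univ x)]
  refine cov.isCovariantDerivativeOn.congr_of_eventuallyEq
    (FiberBundle.mdifferentiableAt_extend ..)
    (mdifferentiableAt_add_section (FiberBundle.mdifferentiableAt_extend ..)
      (FiberBundle.mdifferentiableAt_extend ..)) univ_mem ?_
  filter_upwards [(trivializationAt E (TangentSpace I : N → Type _) x).open_baseSet.mem_nhds
    (FiberBundle.mem_baseSet_trivializationAt' x)] with y hy
  simp only [Pi.add_apply, extend_eq_symmL _ hy, map_add]

theorem cov_extend_smul {x : N} (c : ℝ) (v : TangentSpace I x) :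
    cov (FiberBundle.extend E (c • v)) x = c • cov (FiberBundle.extend E v) x := by
  rw [← cov.isCovariantDerivativeOn.smul_const c (FiberBundle.mdifferentiableAt_extend ..)
    (Set.mem_univ x)]
  refine cov.isCovariantDerivativeOn.congr_of_eventuallyEq
    (FiberBundle.mdifferentiableAt_extend ..)
    (MDifferentiableAt.smul_section (f := fun _ ↦ c) mdifferentiableAt_const (FiberBundle.mdifferentiableAt_extend ..)) univ_mem ?_
  filter_upwards [(trivializationAt E (TangentSpace I : N → Type _) x).open_baseSet.mem_nhds
    (FiberBundle.mem_baseSet_trivializationAt' x)] with y hy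
  rw [extend_eq_symmL _ hy, map_smul, map_smul, ← extend_eq_symmL v hy]
  rfl

theorem covAlong_def (W : Π q : M, TangentSpace I (ι q)) (v : TangentSpace J p) :
    covAlong J cov ι W p v =
      (trivializationAt E (TangentSpace I : N → Type _) (ι p)).symmL ℝ (ι p)
        (mvfderiv J (coordsAlong I ι W p) p v)
      + cov (FiberBundle.extend E (W p)) (ι p) (mfderiv J I ι p v) :=
  rfl

theorem mvfderiv_congr {F : Type*} [NormedAddCommGroup F] [NormedSpace ℝ F] {g g' : M → F}
    (h : g =ᶠ[𝓝 p] g') : mvfderiv J g p = mvfderiv J g' p := by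
  ext v
  simp only [mvfderiv, h.mfderiv_eq]
  rfl

theorem covAlong_add {W V : Π q : M, TangentSpace I (ι q)} (hW : DiffAlongAt J ι W p)
    (hV : DiffAlongAt J ι V p) (v : TangentSpace J p) :
    covAlong J cov ι (fun q ↦ W q + V q) p v
      = covAlong J cov ι W p v + covAlong J cov ι V p v := by
  simp only [covAlong_def, cov_extend_add,
    mvfderiv_congr (J := J) (coordsAlong_add (I := I) hW.mdifferentiableAt.continuousAt W V),
    mvfderiv_add hW.coordsAlong hV.coordsAlong, _root_.add_apply, map_add]
  abel

theorem covAlong_smul {g : M → ℝ} {W : Π q : M, TangentSpace I (ι q)}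
    (hg : MDifferentiableAt J 𝓘(ℝ, ℝ) g p) (hW : DiffAlongAt J ι W p) (v : TangentSpace J p) :
    covAlong J cov ι (fun q ↦ g q • W q) p v
      = g p • covAlong J cov ι W p v + mvfderiv J g p v • W p := by
  have hp := FiberBundle.mem_baseSet_trivializationAt' (F := E) (E := TangentSpace I) (ι p)
  simp only [covAlong_def, cov_extend_smul,
    mvfderiv_congr (J := J) (coordsAlong_smul (I := I) hW.mdifferentiableAt.continuousAt g W),
    mvfderiv_smul hg hW.coordsAlong, _root_.add_apply, map_add,
    _root_.smul_apply, map_smul, ContinuousLinearMap.smulRight_apply,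
    symmL_coordsAlong hp, smul_add]
  abel

variable [FiniteDimensional ℝ E]

theorem cov_eq_symmL_mvfderiv_add {Z : Π y : N, TangentSpace I y} {x : N}
    (hZ : MDifferentiableAt I I.tangent (fun y ↦ (⟨y, Z y⟩ : TangentBundle I N)) x)
    (v : TangentSpace I x) :
    cov Z x v = (trivializationAt E (TangentSpace I : N → Type _) x).symmL ℝ x
        (mvfderiv I (coordsAlong I (fun y ↦ y) Z x) x v) +
          cov (FiberBundle.extend E (Z x)) x v := by
  have hid : mfderiv I I (fun y : N ↦ y) x v = v := by
    change mfderiv I I (id : N → N) x v = v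
    rw [mfderiv_id]; rfl
  let A (W : Π y : N, TangentSpace I y) : TangentSpace I x := covAlong I cov (fun y ↦ y) W x v
  have hA (W : Π y : N, TangentSpace I y) :
      A W = (trivializationAt E (TangentSpace I : N → Type _) x).symmL ℝ x
        (mvfderiv I (coordsAlong I (fun y ↦ y) W x) x v) +
          cov (FiberBundle.extend E (W x)) x v := by
    refine (covAlong_def cov W v).trans ?_
    rw [hid]
  have key : TensorialAt I E (fun W : Π y : N, TangentSpace I y ↦ cov W x v - A W) x :=
    { smul := fun {g W} hg hW ↦ by
        rw [cov.isCovariantDerivativeOn.leibniz hW hg (Set.mem_univ x),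
          show A (g • W) = g x • A W + mvfderiv I g x v • W x from covAlong_smul cov hg hW v,
          smul_sub]
        exact add_sub_add_right_eq_sub _ _ _
      add := fun {W V} hW hV ↦ by
        rw [cov.isCovariantDerivativeOn.add hW hV (Set.mem_univ x),
          show A (W + V) = A W + A V from covAlong_add cov hW hV v]
        exact add_sub_add_comm _ _ _ _ }
  have h := key.pointwise hZ (FiberBundle.mdifferentiableAt_extend I E (Z x))
    (FiberBundle.extend_apply_self E (Z x)).symm
  have hE : mvfderiv I (coordsAlong I (fun y ↦ y) (FiberBundle.extend E (Z x)) x) x = 0 := by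
    rw [mvfderiv_congr (J := I)
      (coordsAlong_extend (I := I) (ι := fun y : N ↦ y) continuousAt_id rfl (Z x)), mvfderiv_const]
  have h0 : cov (FiberBundle.extend E (Z x)) x v - A (FiberBundle.extend E (Z x)) = 0 := by
    rw [hA, hE, FiberBundle.extend_apply_self, _root_.zero_apply, map_zero, zero_add,
      sub_self]
  rw [← hA]
  exact sub_eq_zero.1 (h.trans h0)

theorem covAlong_comp (hι : MDifferentiableAt J I ι p) {Z : Π y : N, TangentSpace I y}
    (hZ : MDifferentiableAt I I.tangent (fun y ↦ (⟨y, Z y⟩ : TangentBundle I N)) (ι p))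
    (v : TangentSpace J p) :
    covAlong J cov ι (fun q ↦ Z (ι q)) p v = cov Z (ι p) (mfderiv J I ι p v) := by
  have hZ' : MDifferentiableAt I 𝓘(ℝ, E) (coordsAlong I (fun y ↦ y) Z (ι p)) (ι p) :=
    DiffAlongAt.coordsAlong (J := I) (ι := fun y ↦ y) hZ
  rw [cov_eq_symmL_mvfderiv_add cov hZ, covAlong_def]
  congr 2
  have hc : coordsAlong I ι (fun q ↦ Z (ι q)) p = coordsAlong I (fun y ↦ y) Z (ι p) ∘ ι := rfl
  have := mfderiv_comp_apply p hZ' hι v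
  rw [hc]
  simp only [mvfderiv, ContinuousLinearMap.comp_apply, this]
  rfl

end CovAlong

section Compatibility

variable {E : Type*} [NormedAddCommGroup E] [NormedSpace ℝ E] [FiniteDimensional ℝ E]
  {H : Type*} [TopologicalSpace H] {I : ModelWithCorners ℝ E H}
  {N : Type*} [TopologicalSpace N] [ChartedSpace H N] [IsManifold I ∞ N]
  [RiemannianBundle (fun x : N ↦ TangentSpace I x)]
  {E' : Type*} [NormedAddCommGroup E'] [NormedSpace ℝ E']
  {H' : Type*} [TopologicalSpace H'] {J : ModelWithCorners ℝ E' H'}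
  {M : Type*} [TopologicalSpace M] [ChartedSpace H' M]
  {ι : M → N} {p : M} {cov : CovariantDerivative I E (TangentSpace I : N → Type _)}

theorem DiffAlongAt.inner [IsContMDiffRiemannianBundle I ∞ E (fun x : N ↦ TangentSpace I x)]
    {W V : Π q : M, TangentSpace I (ι q)} (hW : DiffAlongAt J ι W p) (hV : DiffAlongAt J ι V p) :
    MDifferentiableAt J 𝓘(ℝ, ℝ) (fun q ↦ ⟪W q, V q⟫_ℝ) p :=
  MDifferentiableAt.inner_bundle (F := E) (IB := I) hW hV

/-- The Levi-Civita connection is metric on vector fields along a map. -/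
theorem IsLeviCivita.mvfderiv_inner_along
    [IsContMDiffRiemannianBundle I ∞ E (fun x : N ↦ TangentSpace I x)] (h : IsLeviCivita cov)
    {W V : Π q : M, TangentSpace I (ι q)} (hW : DiffAlongAt J ι W p) (hV : DiffAlongAt J ι V p)
    (v : TangentSpace J p) :
    mvfderiv J (fun q ↦ ⟪W q, V q⟫_ℝ) p v
      = ⟪covAlong J cov ι W p v, V p⟫_ℝ + ⟪W p, covAlong J cov ι V p v⟫_ℝ := by
  have hι := hW.mdifferentiableAt
  let Ψ (W V : Π q : M, TangentSpace I (ι q)) : ℝ := mvfderiv J (fun q ↦ ⟪W q, V q⟫_ℝ) p v -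
    (⟪covAlong J cov ι W p v, V p⟫_ℝ + ⟪W p, covAlong J cov ι V p v⟫_ℝ)
  have hΨ : ∀ W V, Ψ W V = Ψ V W := fun W V ↦ by
    simp only [Ψ, real_inner_comm]; ring
  have key {V : Π q : M, TangentSpace I (ι q)} (hV : DiffAlongAt J ι V p) :
      TensorialAlong J ι p (Ψ · V) :=
    { smul := fun {g W} hg hW ↦ by
        have h1 : mvfderiv J (fun q ↦ g q * ⟪W q, V q⟫_ℝ) p v =
            g p * mvfderiv J (fun q ↦ ⟪W q, V q⟫_ℝ) p v + mvfderiv J g p v * ⟪W p, V p⟫_ℝ := by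
          have := congrArg (fun L ↦ L v) (mvfderiv_smul hg (hW.inner hV))
          simp only [_root_.add_apply, _root_.smul_apply,
            ContinuousLinearMap.smulRight_apply, smul_eq_mul] at this
          exact this
        simp only [Ψ, real_inner_smul_left, h1, covAlong_smul cov hg hW, inner_add_left,
          smul_eq_mul]
        ring
      add := fun {W W'} hW hW' ↦ by
        have h1 : mvfderiv J (fun q ↦ ⟪W q, V q⟫_ℝ + ⟪W' q, V q⟫_ℝ) p v =
            mvfderiv J (fun q ↦ ⟪W q, V q⟫_ℝ) p v + mvfderiv J (fun q ↦ ⟪W' q, V q⟫_ℝ) p v := by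
          have := congrArg (fun L ↦ L v) (mvfderiv_add (hW.inner hV) (hW'.inner hV))
          simp only [_root_.add_apply] at this
          exact this
        simp only [Ψ, inner_add_left, h1, covAlong_add cov hW hW']
        ring }
  have hE (w : TangentSpace I (ι p)) :
      DiffAlongAt J ι (fun q ↦ FiberBundle.extend E w (ι q)) p :=
    DiffAlongAt.comp hι (FiberBundle.mdifferentiableAt_extend ..)
  have hbase (a b : TangentSpace I (ι p)) :
      Ψ (fun q ↦ FiberBundle.extend E a (ι q)) (fun q ↦ FiberBundle.extend E b (ι q)) = 0 := by
    have ha := FiberBundle.mdifferentiableAt_extend I E a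
    have hb := FiberBundle.mdifferentiableAt_extend I E b
    simp only [Ψ, covAlong_comp cov hι ha, covAlong_comp cov hι hb]
    rw [sub_eq_zero, ← h.metric _ _ _ _ ha hb]
    have hd : MDifferentiableAt I 𝓘(ℝ, ℝ)
        (fun y ↦ ⟪FiberBundle.extend E a y, FiberBundle.extend E b y⟫_ℝ) (ι p) :=
      MDifferentiableAt.inner_bundle (F := E) (IB := I) ha hb
    exact mvfderiv_comp_apply (g := fun y ↦
      ⟪FiberBundle.extend E a y, FiberBundle.extend E b y⟫_ℝ) p hd hι v
  have h0 : Ψ W V = 0 := by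
    rw [(key hV).apply_eq hW, hΨ, (key (hE _)).apply_eq hV, hbase]
  exact sub_eq_zero.1 h0

theorem AlmostContactMetric.diffAlongAt_φ (S : AlmostContactMetric I N)
    {W : Π q : M, TangentSpace I (ι q)} (hW : DiffAlongAt J ι W p) :
    DiffAlongAt J ι (fun q ↦ S.φ (ι q) (W q)) p := by
  have h := (S.contMDiff_φ.mdifferentiable (by simp)) (ι p)
  exact MDifferentiableAt.clm_bundle_apply (F₁ := E) (F₂ := E)
    (E₁ := fun x : N ↦ TangentSpace I x) (E₂ := fun x : N ↦ TangentSpace I x)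
    (ϕ := fun q ↦ S.φ (ι q)) (MDifferentiableAt.comp p h hW.mdifferentiableAt) hW

theorem IsKenmotsu.covAlong_φ {S : AlmostContactMetric I N} (h : IsKenmotsu S cov)
    {W : Π q : M, TangentSpace I (ι q)} (hW : DiffAlongAt J ι W p) (v : TangentSpace J p) :
    covAlong J cov ι (fun q ↦ S.φ (ι q) (W q)) p v - S.φ (ι p) (covAlong J cov ι W p v)
      = ⟪S.φ (ι p) (mfderiv J I ι p v), W p⟫_ℝ • S.ξ (ι p)
        - S.η (ι p) (W p) • S.φ (ι p) (mfderiv J I ι p v) := by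
  have hι := hW.mdifferentiableAt
  have key : TensorialAlong J ι p (fun W ↦
      covAlong J cov ι (fun q ↦ S.φ (ι q) (W q)) p v - S.φ (ι p) (covAlong J cov ι W p v)
      - (⟪S.φ (ι p) (mfderiv J I ι p v), W p⟫_ℝ • S.ξ (ι p)
        - S.η (ι p) (W p) • S.φ (ι p) (mfderiv J I ι p v))) :=
    { smul := fun {g W} hg hW ↦ by
        simp only [map_smul, covAlong_smul cov hg hW, covAlong_smul cov hg (S.diffAlongAt_φ hW),
          map_add, inner_smul_right, smul_eq_mul]
        module
      add := fun {W V} hW hV ↦ by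
        simp only [map_add, covAlong_add cov hW hV,
          covAlong_add cov (S.diffAlongAt_φ hW) (S.diffAlongAt_φ hV), inner_add_right]
        module }
  have ha := FiberBundle.mdifferentiableAt_extend I E (W p)
  have hφa : MDifferentiableAt I I.tangent
      (fun y ↦ (⟨y, S.φ y (FiberBundle.extend E (W p) y)⟩ : TangentBundle I N)) (ι p) :=
    S.diffAlongAt_φ (J := I) (ι := fun y ↦ y) ha
  have h1 := key.apply_eq hW
  rw [covAlong_comp cov hι ha, covAlong_comp cov hι hφa, h.cov_φ _ _ _ ha, sub_self] at h1
  exact sub_eq_zero.1 h1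

end Compatibility

section Symmetry

variable {E : Type*} [NormedAddCommGroup E] [NormedSpace ℝ E]
  {H : Type*} [TopologicalSpace H] {I : ModelWithCorners ℝ E H}
  {N : Type*} [TopologicalSpace N] [ChartedSpace H N] [IsManifold I ∞ N]
  {E' : Type*} [NormedAddCommGroup E'] [NormedSpace ℝ E']
  {H' : Type*} [TopologicalSpace H'] {J : ModelWithCorners ℝ E' H'}
  {M : Type*} [TopologicalSpace M] [ChartedSpace H' M] [IsManifold J ∞ M]
  {ι : M → N} {p : M} {cov : CovariantDerivative I E (TangentSpace I : N → Type _)}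

theorem mlieBracket_extend (x : N) (v w : TangentSpace I x) :
    VectorField.mlieBracket I (FiberBundle.extend E v) (FiberBundle.extend E w) x = 0 := by
  have key (u : TangentSpace I x) : VectorField.mpullbackWithin 𝓘(ℝ, E) I (extChartAt I x).symm
      (FiberBundle.extend E u) (Set.range I) =ᶠ[𝓝[Set.range I] (extChartAt I x x)]
      fun _ ↦ (trivializationAt E (TangentSpace I : N → Type _) x).continuousLinearMapAt ℝ x u := by
    filter_upwards [extChartAt_target_mem_nhdsWithin x] with z hz
    have hz' : (extChartAt I x).symm z ∈ (chartAt H x).source := by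
      simpa using (extChartAt I x).map_target hz
    rw [VectorField.mpullbackWithin_apply, extend_eq_symmL u (by simpa using hz'),
      TangentBundle.symmL_trivializationAt hz', (extChartAt I x).right_inv hz]
    exact (isInvertible_mfderivWithin_extChartAt_symm hz).inverse_apply_eq.2 rfl
  have hx (u : TangentSpace I x) := (key u).self_of_nhdsWithin (Set.mem_range_self _)
  rw [← VectorField.mlieBracketWithin_univ, VectorField.mlieBracketWithin_apply, Set.preimage_univ,
    Set.univ_inter, (key v).lieBracketWithin_vectorField_eq (hx v) (key w) (hx w)]
  simp only [VectorField.lieBracketWithin, fderivWithin_fun_const, Pi.zero_apply,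
    _root_.zero_apply, sub_self]
  exact map_zero _

theorem cov_extend_symm [FiniteDimensional ℝ E] (h : cov.torsion = 0) {x : N} (v w : TangentSpace I x) :
    cov (FiberBundle.extend E v) x w = cov (FiberBundle.extend E w) x v := by
  have := cov.torsion_eq_zero_iff.1 h
    (FiberBundle.mdifferentiableAt_extend I E v) (FiberBundle.mdifferentiableAt_extend I E w)
  rw [mlieBracket_extend, FiberBundle.extend_apply_self, FiberBundle.extend_apply_self] at this
  exact (sub_eq_zero.1 this).symm

/-- The differential of `ι` in the preferred trivializations at `p` and `ι p`. -/
theorem contMDiffAt_coordDeriv (hι : ContMDiffAt J I ∞ ι p) :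
    ContMDiffAt J 𝓘(ℝ, E' →L[ℝ] E) ∞
      (inTangentCoordinates J I id ι (mfderiv J I ι) p) p :=
  hι.mfderiv_const (by simp)

theorem coordsAlong_mfderiv (hι : ContinuousAt ι p) (Y : Π q : M, TangentSpace J q) :
    ∀ᶠ q in 𝓝 p, coordsAlong I ι (fun q ↦ mfderiv J I ι q (Y q)) p q =
      inTangentCoordinates J I id ι (mfderiv J I ι) p q
        (coordsAlong J (fun q : M ↦ q) Y p q) := by
  filter_upwards [eventually_mem_baseSet (I := I) hι,
    eventually_mem_baseSet (I := J) (ι := fun q : M ↦ q) continuousAt_id] with q hq hq'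
  rw [coordsAlong_apply hq]
  conv_lhs => rw [← symmL_coordsAlong (ι := fun q : M ↦ q) (W := Y) hq']
  rfl

theorem diffAlongAt_mfderiv (hι : ContMDiffAt J I ∞ ι p) {Y : Π q : M, TangentSpace J q}
    (hY : MDifferentiableAt J J.tangent (fun q ↦ (⟨q, Y q⟩ : TangentBundle J M)) p) :
    DiffAlongAt J ι (fun q ↦ mfderiv J I ι q (Y q)) p := by
  have hY' : MDifferentiableAt J 𝓘(ℝ, E') (coordsAlong J (fun q : M ↦ q) Y p) p :=
    DiffAlongAt.coordsAlong (ι := fun q : M ↦ q) hY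
  refine diffAlongAt_iff.2 ⟨hι.mdifferentiableAt (by simp), ?_⟩
  exact (((contMDiffAt_coordDeriv hι).mdifferentiableAt (by simp)).clm_apply
    hY').congr_of_eventuallyEq (coordsAlong_mfderiv hι.continuousAt Y)

theorem coordsAlong_extend_self (u : TangentSpace J p) :
    coordsAlong J (fun q : M ↦ q) (FiberBundle.extend E' u) p =ᶠ[𝓝 p] fun _ ↦ u := by
  filter_upwards [coordsAlong_extend (I := J) (ι := fun q : M ↦ q) (p := p) continuousAt_id rfl u]
    with q hq
  rw [hq, TangentBundle.continuousLinearMapAt_trivializationAt (mem_chart_source H' p),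
    mfderiv_extChartAt_self]
  rfl

variable [J.Boundaryless]

theorem coordDeriv_eq_fderiv (hι : ContMDiffAt J I ∞ ι p) :
    ∀ᶠ q in 𝓝 p, inTangentCoordinates J I id ι (mfderiv J I ι) p q =
      fderiv ℝ (writtenInExtChartAt J I p ι) (extChartAt J p q) := by
  have hcont : ∀ᶠ q in 𝓝 p, MDifferentiableAt J I ι q :=
    ((contMDiffAt_iff_contMDiffAt_nhds (by simp)).1 (hι.of_le (m := 1) (by norm_cast))).mono
      fun q hq ↦ hq.mdifferentiableAt (by simp)
  filter_upwards [hcont, hι.continuousAt (chart_source_mem_nhds H (ι p)),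
    chart_source_mem_nhds H' p] with q hq h1 h2
  rw [inTangentCoordinates_eq_mfderiv_comp h2 h1]
  have hq' : extChartAt J p q ∈ (extChartAt J p).target :=
    (extChartAt J p).map_source (by simpa using h2)
  have hqq : (extChartAt J p).symm (extChartAt J p q) = q :=
    (extChartAt J p).left_inv (by simpa using h2)
  have hs : MDifferentiableAt 𝓘(ℝ, E') J (extChartAt J p).symm (extChartAt J p q) := by
    have := mdifferentiableWithinAt_extChartAt_symm hq'
    rwa [J.range_eq_univ, mdifferentiableWithinAt_univ] at this
  have hq2 : MDifferentiableAt J I ι ((extChartAt J p).symm (extChartAt J p q)) := by rwa [hqq]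
  have h3 : MDifferentiableAt I 𝓘(ℝ, E) (extChartAt I (ι p))
      (ι ((extChartAt J p).symm (extChartAt J p q))) := by
    rw [hqq]; exact mdifferentiableAt_extChartAt h1
  have h4 (q' : M) (hqq' : q' = q) (w : E') :
      (mfderiv I 𝓘(ℝ, E) (extChartAt I (ι p)) (ι q) (mfderiv J I ι q w) : E) =
        mfderiv I 𝓘(ℝ, E) (extChartAt I (ι p)) (ι q') (mfderiv J I ι q' w) := by
    subst hqq'; rfl
  ext u
  have h5 : mfderiv 𝓘(ℝ, E') 𝓘(ℝ, E) (extChartAt I (ι p) ∘ ι ∘ (extChartAt J p).symm)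
      (extChartAt J p q) u = mfderiv I 𝓘(ℝ, E) (extChartAt I (ι p))
        (ι ((extChartAt J p).symm (extChartAt J p q)))
        (mfderiv J I ι ((extChartAt J p).symm (extChartAt J p q))
          (mfderiv 𝓘(ℝ, E') J (extChartAt J p).symm (extChartAt J p q) u)) := by
    refine (mfderiv_comp_apply (f := ι ∘ (extChartAt J p).symm) (extChartAt J p q) h3
      (hq2.comp _ hs) u).trans ?_
    rw [mfderiv_comp_apply _ hq2 hs]
    rfl
  rw [← mfderiv_eq_fderiv, writtenInExtChartAt]
  refine (h4 _ hqq _).trans (Eq.trans ?_ h5.symm)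
  have h6 : (mfderivWithin 𝓘(ℝ, E') J (extChartAt J p).symm (Set.range J) (extChartAt J p q) u : E')
      = mfderiv 𝓘(ℝ, E') J (extChartAt J p).symm (extChartAt J p q) u := by
    rw [J.range_eq_univ, mfderivWithin_univ]
  exact congrArg (fun w : E' ↦ (mfderiv I 𝓘(ℝ, E) (extChartAt I (ι p))
        (ι ((extChartAt J p).symm (extChartAt J p q)))
        (mfderiv J I ι ((extChartAt J p).symm (extChartAt J p q)) w) : E)) h6

theorem covAlong_mfderiv_extend_symm [FiniteDimensional ℝ E] (h : cov.torsion = 0)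
    (hι : ContMDiffAt J I ∞ ι p) (u v : TangentSpace J p) :
    covAlong J cov ι (fun q ↦ mfderiv J I ι q (FiberBundle.extend E' u q)) p v =
      covAlong J cov ι (fun q ↦ mfderiv J I ι q (FiberBundle.extend E' v q)) p u := by
  have hF : ContDiffAt ℝ ∞ (writtenInExtChartAt J I p ι) (extChartAt J p p) := by
    have := (contMDiffAt_iff.1 hι).2
    rwa [J.range_eq_univ, contDiffWithinAt_univ] at this
  have hF' : DifferentiableAt ℝ (fderiv ℝ (writtenInExtChartAt J I p ι)) (extChartAt J p p) :=
    (hF.fderiv_right (m := 1) (by norm_cast)).differentiableAt (by simp)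
  have h5 (u v : E') : fderiv ℝ (fun z ↦ fderiv ℝ (writtenInExtChartAt J I p ι) z u)
      (extChartAt J p p) v =
        fderiv ℝ (fderiv ℝ (writtenInExtChartAt J I p ι)) (extChartAt J p p) v u := by
    rw [fderiv_clm_apply hF' (differentiableAt_const u)]
    simp only [fderiv_fun_const, Pi.zero_apply, ContinuousLinearMap.comp_zero, zero_add,
      ContinuousLinearMap.flip_apply]
  have hψ : MDifferentiableAt J 𝓘(ℝ, E') (extChartAt J p) p :=
    mdifferentiableAt_extChartAt (mem_chart_source H' p)
  have key (u v : TangentSpace J p) : mvfderiv J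
      (coordsAlong I ι (fun q ↦ mfderiv J I ι q (FiberBundle.extend E' u q)) p) p v =
        fderiv ℝ (fderiv ℝ (writtenInExtChartAt J I p ι)) (extChartAt J p p) v u := by
    have h1 : coordsAlong I ι (fun q ↦ mfderiv J I ι q (FiberBundle.extend E' u q)) p =ᶠ[𝓝 p]
        (fun z ↦ fderiv ℝ (writtenInExtChartAt J I p ι) z u) ∘ extChartAt J p := by
      filter_upwards [coordsAlong_mfderiv (I := I) hι.continuousAt (FiberBundle.extend E' u),
        coordDeriv_eq_fderiv hι, coordsAlong_extend_self (J := J) (p := p) u] with q hq hq' hq''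
      rw [hq, hq', hq'']
      rfl
    rw [mvfderiv_congr (J := J) h1]
    have h2 : DifferentiableAt ℝ (fun z ↦ fderiv ℝ (writtenInExtChartAt J I p ι) z u)
        (extChartAt J p p) := hF'.clm_apply (differentiableAt_const u)
    have h3 := mfderiv_comp_apply p h2.mdifferentiableAt hψ v
    rw [mfderiv_extChartAt_self, mfderiv_eq_fderiv] at h3
    refine h3.trans ?_
    exact h5 u v
  have hsymm : IsSymmSndFDerivAt ℝ (writtenInExtChartAt J I p ι) (extChartAt J p p) :=
    hF.isSymmSndFDerivAt (by simpa using by norm_cast)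
  rw [covAlong_def, covAlong_def, key, key, FiberBundle.extend_apply_self,
    FiberBundle.extend_apply_self, cov_extend_symm h]
  congr 2
  exact hsymm.eq v u

end Symmetry

section ProductFields

variable {E' : Type*} [NormedAddCommGroup E'] [NormedSpace ℝ E']
  {H' : Type*} [TopologicalSpace H'] {J : ModelWithCorners ℝ E' H'}
  {M : Type*} [TopologicalSpace M] [ChartedSpace H' M] [IsManifold J ∞ M]
  {F : Type*} [NormedAddCommGroup F] [NormedSpace ℝ F]
  {K : Type*} [TopologicalSpace K] {J' : ModelWithCorners ℝ F K}
  {M' : Type*} [TopologicalSpace M'] [ChartedSpace K M'] [IsManifold J' ∞ M']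

theorem extend_zero {x y : M} (hy : y ∈ (chartAt H' x).source) :
    FiberBundle.extend E' (0 : TangentSpace J x) y = 0 := by
  rw [extend_eq_symmL _ (by simpa using hy), map_zero, map_zero]

theorem mfderiv_extChartAt_extend {p q : M} (hq : q ∈ (chartAt H' p).source)
    (u : TangentSpace J p) :
    (mfderiv J 𝓘(ℝ, E') (extChartAt J p) q (FiberBundle.extend E' u q) : E') = u := by
  have hq' : q ∈ (trivializationAt E' (TangentSpace J : M → Type _) p).baseSet := by simpa using hq
  rw [extend_eq_symmL u hq', ← TangentBundle.continuousLinearMapAt_trivializationAt hq]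
  refine (Trivialization.continuousLinearMapAt_symmL _ hq' _).trans ?_
  rw [TangentBundle.continuousLinearMapAt_trivializationAt (mem_chart_source _ _),
    mfderiv_extChartAt_self]
  rfl

/-- If `r` is linear in the preferred charts at `p` and `r p`, its differential maps fields that
are constant in one chart to fields that are constant in the other. -/
theorem mfderiv_extend {r : M → M'} (hr : MDifferentiable J J' r) {p : M} (L : E' →L[ℝ] F)
    (hL : extChartAt J' (r p) ∘ r = L ∘ extChartAt J p) (u : TangentSpace J p) :
    ∀ᶠ q in 𝓝 p, mfderiv J J' r q (FiberBundle.extend E' u q) =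
      FiberBundle.extend F (mfderiv J J' r p u) (r q) := by
  have key (q : M) (h1 : q ∈ (chartAt H' p).source) (h2 : r q ∈ (chartAt K (r p)).source)
      (w : TangentSpace J q) :
      (mfderiv J' 𝓘(ℝ, F) (extChartAt J' (r p)) (r q) (mfderiv J J' r q w) : F) =
        L (mfderiv J 𝓘(ℝ, E') (extChartAt J p) q w) := by
    have e1 := mfderiv_comp_apply q (mdifferentiableAt_extChartAt h2) (hr q) w
    have e2 := mfderiv_comp_apply q (L.differentiableAt.mdifferentiableAt
      (x := extChartAt J p q)) (mdifferentiableAt_extChartAt h1) w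
    rw [← hL] at e2
    rw [mfderiv_eq_fderiv, L.fderiv] at e2
    exact e1.symm.trans e2
  have hp (w : TangentSpace J p) : (mfderiv J J' r p w : F) = L w := by
    have := key p (mem_chart_source _ _) (mem_chart_source _ _) w
    rw [mfderiv_extChartAt_self, mfderiv_extChartAt_self] at this
    exact this
  filter_upwards [chart_source_mem_nhds H' p,
    hr.continuous.continuousAt (chart_source_mem_nhds K (r p))] with q h1 h2
  have h3 := (key q h1 h2 (FiberBundle.extend E' u q)).trans
    (congrArg L (mfderiv_extChartAt_extend h1 u))
  have h4 := mfderiv_extChartAt_extend h2 (mfderiv J J' r p u)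
  exact (isInvertible_mfderiv_extChartAt (by simpa using h2)).injective
    (h3.trans ((hp u).symm.trans h4.symm))

end ProductFields

section SecondFF

variable {E : Type*} [NormedAddCommGroup E] [NormedSpace ℝ E] [FiniteDimensional ℝ E]
  {H : Type*} [TopologicalSpace H] {I : ModelWithCorners ℝ E H}
  {N : Type*} [TopologicalSpace N] [ChartedSpace H N] [IsManifold I ∞ N]
  [RiemannianBundle (fun x : N ↦ TangentSpace I x)]
  {E' : Type*} [NormedAddCommGroup E'] [NormedSpace ℝ E'] [FiniteDimensional ℝ E']
  {H' : Type*} [TopologicalSpace H'] {J : ModelWithCorners ℝ E' H'}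
  {M : Type*} [TopologicalSpace M] [ChartedSpace H' M] [IsManifold J ∞ M]
  {ι : M → N} {p : M} {cov : CovariantDerivative I E (TangentSpace I : N → Type _)}

theorem starProjection_normal_mfderiv (v : TangentSpace J p) :
    (normal I J ι p).starProjection (mfderiv J I ι p v) = 0 := by
  rw [Submodule.starProjection_apply_eq_zero_iff, normal]
  exact Submodule.le_orthogonal_orthogonal _ ⟨v, rfl⟩

/-- The second fundamental form is tensorial in its second argument. -/
theorem secondFF_eq_extend (hι : ContMDiffAt J I ∞ ι p) (X : Π q : M, TangentSpace J q)
    {Y : Π q : M, TangentSpace J q}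
    (hY : MDifferentiableAt J J.tangent (fun q ↦ (⟨q, Y q⟩ : TangentBundle J M)) p) :
    secondFF J cov ι X Y p = secondFF J cov ι X (FiberBundle.extend E' (Y p)) p := by
  have key : TensorialAt J E' (fun Y : Π q : M, TangentSpace J q ↦ secondFF J cov ι X Y p) p :=
    { smul := fun {g Y} hg hY ↦ by
        have h := covAlong_smul cov hg (diffAlongAt_mfderiv hι hY) (X p)
        simp only [secondFF, Pi.smul_apply', map_smul]
        rw [h, map_add, map_smul, map_smul, starProjection_normal_mfderiv, smul_zero, add_zero]
      add := fun {Y Z} hY hZ ↦ by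
        have h := covAlong_add cov (diffAlongAt_mfderiv hι hY) (diffAlongAt_mfderiv hι hZ) (X p)
        simp only [secondFF, Pi.add_apply, map_add]
        rw [h, map_add] }
  exact key.pointwise hY (FiberBundle.mdifferentiableAt_extend J E' (Y p))
    (FiberBundle.extend_apply_self E' (Y p)).symm

end SecondFF

section WarpedProduct

variable {E : Type*} [NormedAddCommGroup E] [NormedSpace ℝ E] [FiniteDimensional ℝ E]
  {H : Type*} [TopologicalSpace H] {I : ModelWithCorners ℝ E H}
  {N : Type*} [TopologicalSpace N] [ChartedSpace H N] [IsManifold I ∞ N]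
  [RiemannianBundle (fun x : N ↦ TangentSpace I x)]
  {E₁ : Type*} [NormedAddCommGroup E₁] [NormedSpace ℝ E₁]
  {H₁ : Type*} [TopologicalSpace H₁] {J₁ : ModelWithCorners ℝ E₁ H₁}
  {M₁ : Type*} [TopologicalSpace M₁] [ChartedSpace H₁ M₁] [IsManifold J₁ ∞ M₁]
  {E₂ : Type*} [NormedAddCommGroup E₂] [NormedSpace ℝ E₂]
  {H₂ : Type*} [TopologicalSpace H₂] {J₂ : ModelWithCorners ℝ E₂ H₂}
  {M₂ : Type*} [TopologicalSpace M₂] [ChartedSpace H₂ M₂] [IsManifold J₂ ∞ M₂]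
  {ι : M₁ × M₂ → N}
  {g₁ : ContMDiffRiemannianMetric J₁ ∞ E₁ (fun x : M₁ ↦ TangentSpace J₁ x)}
  {g₂ : ContMDiffRiemannianMetric J₂ ∞ E₂ (fun x : M₂ ↦ TangentSpace J₂ x)}
  {f : M₁ → ℝ} {p : M₁ × M₂} {cov : CovariantDerivative I E (TangentSpace I : N → Type _)}

theorem mfderiv_fst_extend (u : TangentSpace (J₁.prod J₂) p) :
    ∀ᶠ q in 𝓝 p, mfderiv (J₁.prod J₂) J₁ Prod.fst q (FiberBundle.extend (E₁ × E₂) u q) =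
      FiberBundle.extend E₁ (mfderiv (J₁.prod J₂) J₁ Prod.fst p u) q.1 :=
  mfderiv_extend mdifferentiable_fst (ContinuousLinearMap.fst ℝ E₁ E₂) (by
    rw [extChartAt_prod]; rfl) u

theorem mfderiv_snd_extend (u : TangentSpace (J₁.prod J₂) p) :
    ∀ᶠ q in 𝓝 p, mfderiv (J₁.prod J₂) J₂ Prod.snd q (FiberBundle.extend (E₁ × E₂) u q) =
      FiberBundle.extend E₂ (mfderiv (J₁.prod J₂) J₂ Prod.snd p u) q.2 :=
  mfderiv_extend mdifferentiable_snd (ContinuousLinearMap.snd ℝ E₁ E₂) (by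
    rw [extChartAt_prod]; rfl) u

theorem extend_mem_tangentFst {u : TangentSpace (J₁.prod J₂) p} (hu : u ∈ tangentFst J₁ J₂ p) :
    ∀ᶠ q in 𝓝 p, FiberBundle.extend (E₁ × E₂) u q ∈ tangentFst J₁ J₂ q := by
  filter_upwards [mfderiv_snd_extend u,
    continuousAt_snd (chart_source_mem_nhds H₂ p.2)] with q hq hq'
  rw [show mfderiv (J₁.prod J₂) J₂ Prod.snd p u = 0 from hu, extend_zero hq'] at hq
  exact hq

theorem extend_mem_tangentSnd {u : TangentSpace (J₁.prod J₂) p} (hu : u ∈ tangentSnd J₁ J₂ p) :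
    ∀ᶠ q in 𝓝 p, FiberBundle.extend (E₁ × E₂) u q ∈ tangentSnd J₁ J₂ q := by
  filter_upwards [mfderiv_fst_extend u,
    continuousAt_fst (chart_source_mem_nhds H₁ p.1)] with q hq hq'
  rw [show mfderiv (J₁.prod J₂) J₁ Prod.fst p u = 0 from hu, extend_zero hq'] at hq
  exact hq

namespace IsWarpedProductImmersion

/-- The two factors are orthogonal. -/
theorem inner_eq_zero (h : IsWarpedProductImmersion (I := I) J₁ J₂ ι g₁ g₂ f)
    {u z : TangentSpace (J₁.prod J₂) p} (hu : u ∈ tangentFst J₁ J₂ p)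
    (hz : z ∈ tangentSnd J₁ J₂ p) :
    ⟪mfderiv (J₁.prod J₂) I ι p u, mfderiv (J₁.prod J₂) I ι p z⟫_ℝ = 0 := by
  rw [h.isometric, show mfderiv (J₁.prod J₂) J₂ Prod.snd p u = 0 from hu,
    show mfderiv (J₁.prod J₂) J₁ Prod.fst p z = 0 from hz]
  simp

variable [IsContMDiffRiemannianBundle I ∞ E (fun x : N ↦ TangentSpace I x)]

theorem diffAlongAt_mfderiv_extend (h : IsWarpedProductImmersion (I := I) J₁ J₂ ι g₁ g₂ f)
    (u : TangentSpace (J₁.prod J₂) p) :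
    DiffAlongAt (J₁.prod J₂) ι
      (fun q ↦ mfderiv (J₁.prod J₂) I ι q (FiberBundle.extend (E₁ × E₂) u q)) p :=
  diffAlongAt_mfderiv h.contMDiff_ι.contMDiffAt (FiberBundle.mdifferentiableAt_extend ..)

/-- The inner product of coordinate fields tangent to the first factor is constant along the
second factor. -/
theorem mvfderiv_inner_extend (h : IsWarpedProductImmersion (I := I) J₁ J₂ ι g₁ g₂ f)
    {u w z : TangentSpace (J₁.prod J₂) p} (hu : u ∈ tangentFst J₁ J₂ p)
    (hw : w ∈ tangentFst J₁ J₂ p) (hz : z ∈ tangentSnd J₁ J₂ p) :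
    mvfderiv (J₁.prod J₂) (fun q ↦
      ⟪mfderiv (J₁.prod J₂) I ι q (FiberBundle.extend (E₁ × E₂) u q),
        mfderiv (J₁.prod J₂) I ι q (FiberBundle.extend (E₁ × E₂) w q)⟫_ℝ) p z = 0 := by
  let k (a : M₁) : ℝ := g₁.inner a
    (FiberBundle.extend E₁ (mfderiv (J₁.prod J₂) J₁ Prod.fst p u) a)
    (FiberBundle.extend E₁ (mfderiv (J₁.prod J₂) J₁ Prod.fst p w) a)
  have heq : (fun q ↦ ⟪mfderiv (J₁.prod J₂) I ι q (FiberBundle.extend (E₁ × E₂) u q),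
        mfderiv (J₁.prod J₂) I ι q (FiberBundle.extend (E₁ × E₂) w q)⟫_ℝ) =ᶠ[𝓝 p]
      k ∘ Prod.fst := by
    filter_upwards [extend_mem_tangentFst hu, extend_mem_tangentFst hw, mfderiv_fst_extend u,
      mfderiv_fst_extend w] with q h1 h2 h3 h4
    rw [h.isometric, h3, h4, show mfderiv (J₁.prod J₂) J₂ Prod.snd q
      (FiberBundle.extend (E₁ × E₂) u q) = 0 from h1]
    simp [k]
  have hd : MDifferentiableAt (J₁.prod J₂) 𝓘(ℝ, ℝ) (k ∘ Prod.fst) p :=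
    ((h.diffAlongAt_mfderiv_extend u).inner
      (h.diffAlongAt_mfderiv_extend w)).congr_of_eventuallyEq heq.symm
  have hk : MDifferentiableAt J₁ 𝓘(ℝ, ℝ) k p.1 := by
    have hs : MDifferentiableAt J₁ (J₁.prod J₂) (fun a : M₁ ↦ (a, p.2)) p.1 :=
      mdifferentiableAt_id.prodMk mdifferentiableAt_const
    exact MDifferentiableAt.comp p.1 (g := k ∘ Prod.fst) hd hs
  rw [mvfderiv_congr (J := J₁.prod J₂) heq]
  have := mfderiv_comp_apply p hk mdifferentiableAt_fst z
  rw [show mfderiv (J₁.prod J₂) J₁ Prod.fst p z = 0 from hz, map_zero] at this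
  exact this

variable [J₁.Boundaryless] [J₂.Boundaryless]

/-- The leaves tangent to the first factor are totally geodesic. -/
theorem inner_covAlong_tangentSnd (h : IsWarpedProductImmersion (I := I) J₁ J₂ ι g₁ g₂ f)
    (hc : IsLeviCivita cov) {u w z : TangentSpace (J₁.prod J₂) p}
    (hu : u ∈ tangentFst J₁ J₂ p) (hw : w ∈ tangentFst J₁ J₂ p) (hz : z ∈ tangentSnd J₁ J₂ p) :
    ⟪covAlong (J₁.prod J₂) cov ι
      (fun q ↦ mfderiv (J₁.prod J₂) I ι q (FiberBundle.extend (E₁ × E₂) w q)) p u,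
      mfderiv (J₁.prod J₂) I ι p z⟫_ℝ = 0 := by
  let D (a b : TangentSpace (J₁.prod J₂) p) : TangentSpace I (ι p) :=
    covAlong (J₁.prod J₂) cov ι
      (fun q ↦ mfderiv (J₁.prod J₂) I ι q (FiberBundle.extend (E₁ × E₂) b q)) p a
  have hsymm (a b) : D a b = D b a :=
    covAlong_mfderiv_extend_symm hc.torsion_free h.contMDiff_ι.contMDiffAt b a
  have hmetric (a b c : TangentSpace (J₁.prod J₂) p) := hc.mvfderiv_inner_along
    (h.diffAlongAt_mfderiv_extend a) (h.diffAlongAt_mfderiv_extend b) c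
  have hmixed {a : TangentSpace (J₁.prod J₂) p} (ha : a ∈ tangentFst J₁ J₂ p)
      (c : TangentSpace (J₁.prod J₂) p) :
      ⟪D c a, mfderiv (J₁.prod J₂) I ι p z⟫_ℝ + ⟪mfderiv (J₁.prod J₂) I ι p a, D c z⟫_ℝ = 0 := by
    have heq : (fun q ↦ ⟪mfderiv (J₁.prod J₂) I ι q (FiberBundle.extend (E₁ × E₂) a q),
        mfderiv (J₁.prod J₂) I ι q (FiberBundle.extend (E₁ × E₂) z q)⟫_ℝ) =ᶠ[𝓝 p]
        fun _ ↦ (0 : ℝ) := by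
      filter_upwards [extend_mem_tangentFst ha, extend_mem_tangentSnd hz] with q h1 h2
      exact h.inner_eq_zero h1 h2
    have := hmetric a z c
    rw [mvfderiv_congr (J := J₁.prod J₂) heq, mvfderiv_const, FiberBundle.extend_apply_self,
      FiberBundle.extend_apply_self] at this
    exact this.symm
  have h1 := hmetric u w z
  rw [h.mvfderiv_inner_extend hu hw hz, FiberBundle.extend_apply_self,
    FiberBundle.extend_apply_self] at h1
  have h1' : 0 = ⟪D z u, mfderiv (J₁.prod J₂) I ι p w⟫_ℝ +
    ⟪mfderiv (J₁.prod J₂) I ι p u, D z w⟫_ℝ := h1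
  have h2 := hmixed hu w
  have h3 := hmixed hw u
  rw [hsymm w u] at h2
  rw [hsymm z u, hsymm z w, real_inner_comm] at h1'
  change ⟪D u w, mfderiv (J₁.prod J₂) I ι p z⟫_ℝ = 0
  linarith

theorem inner_covAlong_tangentFst (h : IsWarpedProductImmersion (I := I) J₁ J₂ ι g₁ g₂ f)
    (hc : IsLeviCivita cov) {u w : TangentSpace (J₁.prod J₂) p}
    (hu : u ∈ tangentFst J₁ J₂ p) (hw : w ∈ tangentFst J₁ J₂ p)
    {V : Π q : M₁ × M₂, TangentSpace I (ι q)} (hV : DiffAlongAt (J₁.prod J₂) ι V p)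
    (hV' : ∀ᶠ q in 𝓝 p, V q ∈ (tangentSnd J₁ J₂ q).map
      (mfderiv (J₁.prod J₂) I ι q).toLinearMap) :
    ⟪covAlong (J₁.prod J₂) cov ι V p u, mfderiv (J₁.prod J₂) I ι p w⟫_ℝ = 0 := by
  have heq : (fun q ↦ ⟪V q, mfderiv (J₁.prod J₂) I ι q (FiberBundle.extend (E₁ × E₂) w q)⟫_ℝ)
      =ᶠ[𝓝 p] fun _ ↦ (0 : ℝ) := by
    filter_upwards [extend_mem_tangentFst hw, hV'] with q h1 h2
    obtain ⟨z, hz, hzV⟩ := h2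
    rw [← hzV, real_inner_comm]
    exact h.inner_eq_zero h1 hz
  have h1 := hc.mvfderiv_inner_along hV (h.diffAlongAt_mfderiv_extend w) u
  obtain ⟨z, hz, hzV⟩ := hV'.self_of_nhds
  have h2 := h.inner_covAlong_tangentSnd hc hu hw hz
  have h3 : ⟪V p, covAlong (J₁.prod J₂) cov ι
      (fun q ↦ mfderiv (J₁.prod J₂) I ι q (FiberBundle.extend (E₁ × E₂) w q)) p u⟫_ℝ = 0 := by
    rw [← hzV, real_inner_comm]
    exact h2
  rw [mvfderiv_congr (J := J₁.prod J₂) heq, mvfderiv_const, FiberBundle.extend_apply_self, h3,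
    add_zero] at h1
  exact h1.symm

end IsWarpedProductImmersion

end WarpedProduct

section Distributions

variable {E : Type*} [NormedAddCommGroup E] [NormedSpace ℝ E] [FiniteDimensional ℝ E]
  {H : Type*} [TopologicalSpace H] {I : ModelWithCorners ℝ E H}
  {N : Type*} [TopologicalSpace N] [ChartedSpace H N] [IsManifold I ∞ N]
  [RiemannianBundle (fun x : N ↦ TangentSpace I x)]
  {E' : Type*} [NormedAddCommGroup E'] [NormedSpace ℝ E']
  {H' : Type*} [TopologicalSpace H'] {J : ModelWithCorners ℝ E' H'}
  {M : Type*} [TopologicalSpace M] [ChartedSpace H' M]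
  {S : AlmostContactMetric I N} {ι : M → N} {p : M} {θ : ℝ}

theorem P_mem (v : TangentSpace I (ι p)) : P J S ι p v ∈ tangent I J ι p :=
  Submodule.starProjection_apply_mem _ _

theorem Q_mem (v : TangentSpace I (ι p)) : Q J S ι p v ∈ normal I J ι p :=
  Submodule.starProjection_apply_mem _ _

theorem P_add_Q (v : TangentSpace I (ι p)) : P J S ι p v + Q J S ι p v = S.φ (ι p) v :=
  Submodule.starProjection_add_starProjection_orthogonal (K := tangent I J ι p) _

theorem starProjection_normal_Q (v : TangentSpace I (ι p)) :
    (normal I J ι p).starProjection (Q J S ι p v) = Q J S ι p v :=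
  Submodule.starProjection_eq_self_iff.2 (Q_mem v)

theorem inner_normal_tangent {v w : TangentSpace I (ι p)} (hv : v ∈ normal I J ι p)
    (hw : w ∈ tangent I J ι p) : ⟪v, w⟫_ℝ = 0 :=
  Submodule.inner_left_of_mem_orthogonal hw hv

theorem inner_P_left (v : TangentSpace I (ι p)) {w : TangentSpace I (ι p)}
    (hw : w ∈ tangent I J ι p) : ⟪P J S ι p v, w⟫_ℝ = ⟪S.φ (ι p) v, w⟫_ℝ := by
  rw [← P_add_Q (J := J), inner_add_left, inner_normal_tangent (Q_mem v) hw, add_zero]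

theorem inner_P_skew {v w : TangentSpace I (ι p)} (hv : v ∈ tangent I J ι p)
    (hw : w ∈ tangent I J ι p) : ⟪P J S ι p v, w⟫_ℝ = -⟪v, P J S ι p w⟫_ℝ := by
  rw [inner_P_left v hw, S.inner_φ_left, real_inner_comm, ← inner_P_left w hv, real_inner_comm]

theorem mem_eigenDist {c : ℝ} {v : TangentSpace I (ι p)} :
    v ∈ eigenDist J S ι c p ↔
      v ∈ tangent I J ι p ∧ P J S ι p (P J S ι p v) + c ^ 2 • v = 0 :=
  Iff.rfl

theorem P_mem_eigenDist {c : ℝ} {v : TangentSpace I (ι p)} (hv : v ∈ eigenDist J S ι c p) :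
    P J S ι p v ∈ eigenDist J S ι c p := by
  refine mem_eigenDist.2 ⟨P_mem v, ?_⟩
  rw [← map_smul, ← map_add, (mem_eigenDist.1 hv).2, map_zero]

theorem φ_eq_P_of_mem_distT {v : TangentSpace I (ι p)} (hv : v ∈ distT J S ι p) :
    S.φ (ι p) v = P J S ι p v := by
  obtain ⟨hv1, hv2⟩ := mem_eigenDist.1 hv
  have h1 : ⟪P J S ι p v, P J S ι p v⟫_ℝ = ⟪v, v⟫_ℝ := by
    rw [inner_P_skew hv1 (P_mem v), eq_neg_of_add_eq_zero_left hv2, inner_neg_right]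
    simp
  have h2 := S.inner_φ_φ (ι p) v v
  have h3 := inner_normal_tangent (Q_mem (J := J) (S := S) v) (P_mem (J := J) (S := S) v)
  rw [← P_add_Q (J := J), inner_add_left, inner_add_right, inner_add_right, h1, h3,
    (real_inner_comm _ _).trans h3] at h2
  have h4 : ⟪Q J S ι p v, Q J S ι p v⟫_ℝ = 0 :=
    le_antisymm (by nlinarith [mul_self_nonneg (S.η (ι p) v)]) real_inner_self_nonneg
  rw [← P_add_Q (J := J), inner_self_eq_zero.1 h4, add_zero]

theorem φ_mem_distT {v : TangentSpace I (ι p)} (hv : v ∈ distT J S ι p) :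
    S.φ (ι p) v ∈ distT J S ι p := by
  rw [φ_eq_P_of_mem_distT hv]
  exact P_mem_eigenDist hv

theorem P_eq_zero_of_mem_distPerp {v : TangentSpace I (ι p)} (hv : v ∈ distPerp J S ι p) :
    P J S ι p v = 0 := by
  obtain ⟨hv1, hv2⟩ := mem_eigenDist.1 hv.1
  rw [← inner_self_eq_zero (𝕜 := ℝ), inner_P_skew hv1 (P_mem v)]
  rw [zero_pow two_ne_zero, zero_smul, add_zero] at hv2
  rw [hv2, inner_zero_right, neg_zero]

theorem Q_eq_φ_of_mem_distPerp {v : TangentSpace I (ι p)} (hv : v ∈ distPerp J S ι p) :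
    Q J S ι p v = S.φ (ι p) v := by
  rw [← P_add_Q (J := J), P_eq_zero_of_mem_distPerp hv, zero_add]

theorem mem_nu {v : TangentSpace I (ι p)} :
    v ∈ nu J S ι θ p ↔ v ∈ normal I J ι p ∧ (∀ w ∈ distPerp J S ι p, ⟪S.φ (ι p) w, v⟫_ℝ = 0) ∧
      ∀ w ∈ distSlant J S ι θ p, ⟪Q J S ι p w, v⟫_ℝ = 0 := by
  rw [nu, ← Submodule.inf_orthogonal, Submodule.mem_inf, Submodule.mem_inf,
    Submodule.mem_orthogonal, Submodule.mem_orthogonal]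
  simp only [Submodule.mem_map, forall_exists_index, and_imp, forall_apply_eq_imp_iff₂]
  rfl

/-- The bundle `ν` is invariant under `φ`. -/
theorem IsSkewCROrderOne.φ_mem_nu (h : IsSkewCROrderOne J S ι θ) {v : TangentSpace I (ι p)}
    (hv : v ∈ nu J S ι θ p) : S.φ (ι p) v ∈ nu J S ι θ p := by
  obtain ⟨hn, hperp, hslant⟩ := mem_nu.1 hv
  have hη : S.η (ι p) v = 0 := by
    rw [S.η_eq]; exact inner_normal_tangent hn (h.ξ_mem p)
  have hφ {w : TangentSpace I (ι p)} (hw : w ∈ tangent I J ι p) :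
      ⟪S.φ (ι p) w, S.φ (ι p) v⟫_ℝ = 0 := by
    rw [S.inner_φ_φ, hη, mul_zero, sub_zero, real_inner_comm]
    exact inner_normal_tangent hn hw
  have hnormal : S.φ (ι p) v ∈ normal I J ι p := by
    rw [normal, ← h.decomp p, ← Submodule.inf_orthogonal, ← Submodule.inf_orthogonal,
      ← Submodule.inf_orthogonal]
    have hadj (w : TangentSpace I (ι p)) (hw : ⟪S.φ (ι p) w, v⟫_ℝ = 0) :
        ⟪w, S.φ (ι p) v⟫_ℝ = 0 := by
      rw [S.inner_φ_left] at hw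
      linarith
    refine ⟨⟨⟨?_, ?_⟩, ?_⟩, ?_⟩ <;> refine (Submodule.mem_orthogonal _ _).2 fun w hw ↦ hadj w ?_
    · rw [real_inner_comm]
      exact inner_normal_tangent hn (φ_mem_distT hw).1
    · exact hperp w hw
    · rw [← P_add_Q (J := J), inner_add_left, hslant w hw, add_zero, real_inner_comm]
      exact inner_normal_tangent hn (P_mem w)
    · obtain ⟨c, rfl⟩ := Submodule.mem_span_singleton.1 hw
      rw [map_smul, S.φ_ξ, smul_zero, inner_zero_left]
  refine mem_nu.2 ⟨hnormal, fun w hw ↦ hφ hw.1.1, fun w hw ↦ ?_⟩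
  have h1 := hφ hw.1
  rwa [← P_add_Q (J := J), inner_add_left, real_inner_comm,
    inner_normal_tangent hnormal (P_mem w), zero_add] at h1

end Distributions

section WarpedSkewCR

variable {E : Type*} [NormedAddCommGroup E] [NormedSpace ℝ E] [FiniteDimensional ℝ E]
  {H : Type*} [TopologicalSpace H] {I : ModelWithCorners ℝ E H}
  {N : Type*} [TopologicalSpace N] [ChartedSpace H N] [IsManifold I ∞ N]
  [RiemannianBundle (fun x : N ↦ TangentSpace I x)]
  [IsContMDiffRiemannianBundle I ∞ E (fun x : N ↦ TangentSpace I x)]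
  {E₁ : Type*} [NormedAddCommGroup E₁] [NormedSpace ℝ E₁]
  {H₁ : Type*} [TopologicalSpace H₁] {J₁ : ModelWithCorners ℝ E₁ H₁} [J₁.Boundaryless]
  {M₁ : Type*} [TopologicalSpace M₁] [ChartedSpace H₁ M₁] [IsManifold J₁ ∞ M₁]
  {E₂ : Type*} [NormedAddCommGroup E₂] [NormedSpace ℝ E₂]
  {H₂ : Type*} [TopologicalSpace H₂] {J₂ : ModelWithCorners ℝ E₂ H₂} [J₂.Boundaryless]
  {M₂ : Type*} [TopologicalSpace M₂] [ChartedSpace H₂ M₂] [IsManifold J₂ ∞ M₂]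
  {ι : M₁ × M₂ → N}
  {g₁ : ContMDiffRiemannianMetric J₁ ∞ E₁ (fun x : M₁ ↦ TangentSpace J₁ x)}
  {g₂ : ContMDiffRiemannianMetric J₂ ∞ E₂ (fun x : M₂ ↦ TangentSpace J₂ x)}
  {f : M₁ → ℝ} {p : M₁ × M₂} {cov : CovariantDerivative I E (TangentSpace I : N → Type _)}
  {S : AlmostContactMetric I N}

/-- If `ξ` is tangent to the first factor and the second factor is `φ`-invariant, then
`g(∇_u X, φ w) = 0` for `u`, `w` tangent to the first factor and `X` tangent to the second one. -/
theorem IsWarpedProductImmersion.inner_covAlong_φ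
    (h : IsWarpedProductImmersion (I := I) J₁ J₂ ι g₁ g₂ f) (hS : IsKenmotsu S cov)
    (hξ : S.ξ (ι p) ∈ (tangentFst J₁ J₂ p).map (mfderiv (J₁.prod J₂) I ι p).toLinearMap)
    (hφ : ∀ q, ∀ z ∈ tangentSnd J₁ J₂ q, S.φ (ι q) (mfderiv (J₁.prod J₂) I ι q z) ∈
      (tangentSnd J₁ J₂ q).map (mfderiv (J₁.prod J₂) I ι q).toLinearMap)
    {u w x : TangentSpace (J₁.prod J₂) p} (hu : u ∈ tangentFst J₁ J₂ p)
    (hw : w ∈ tangentFst J₁ J₂ p) (hx : x ∈ tangentSnd J₁ J₂ p) :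
    ⟪covAlong (J₁.prod J₂) cov ι
      (fun q ↦ mfderiv (J₁.prod J₂) I ι q (FiberBundle.extend (E₁ × E₂) x q)) p u,
      S.φ (ι p) (mfderiv (J₁.prod J₂) I ι p w)⟫_ℝ = 0 := by
  have hd := h.diffAlongAt_mfderiv_extend x
  have h1 := h.inner_covAlong_tangentFst hS.isLeviCivita hu hw (S.diffAlongAt_φ hd)
    ((extend_mem_tangentSnd hx).mono fun q hq ↦ hφ q _ hq)
  have h2 := hS.covAlong_φ hd u
  have hη : S.η (ι p) (mfderiv (J₁.prod J₂) I ι p x) = 0 := by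
    obtain ⟨a, ha, haξ⟩ := hξ
    rw [S.η_eq, ← haξ, real_inner_comm]
    exact h.inner_eq_zero ha hx
  have hux : ⟪S.φ (ι p) (mfderiv (J₁.prod J₂) I ι p u), mfderiv (J₁.prod J₂) I ι p x⟫_ℝ = 0 := by
    obtain ⟨z, hz, hzx⟩ := hφ p x hx
    rw [S.inner_φ_left, ← hzx, neg_eq_zero]
    exact h.inner_eq_zero hu hz
  rw [FiberBundle.extend_apply_self, hux, hη, zero_smul, zero_smul, sub_zero] at h2
  rw [sub_eq_zero.1 h2, S.inner_φ_left, neg_eq_zero] at h1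
  exact h1

end WarpedSkewCR

section Main

variable {E : Type*} [NormedAddCommGroup E] [NormedSpace ℝ E] [FiniteDimensional ℝ E]
  {H : Type*} [TopologicalSpace H] {I : ModelWithCorners ℝ E H}
  {N : Type*} [TopologicalSpace N] [ChartedSpace H N] [IsManifold I ∞ N]
  [RiemannianBundle (fun x : N ↦ TangentSpace I x)]
  [IsContMDiffRiemannianBundle I ∞ E (fun x : N ↦ TangentSpace I x)]
  {EA : Type*} [NormedAddCommGroup EA] [NormedSpace ℝ EA]
  {HA : Type*} [TopologicalSpace HA] {JA : ModelWithCorners ℝ EA HA}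
  {A : Type*} [TopologicalSpace A] [ChartedSpace HA A]
  {EB : Type*} [NormedAddCommGroup EB] [NormedSpace ℝ EB]
  {HB : Type*} [TopologicalSpace HB] {JB : ModelWithCorners ℝ EB HB}
  {B : Type*} [TopologicalSpace B] [ChartedSpace HB B]
  {EC : Type*} [NormedAddCommGroup EC] [NormedSpace ℝ EC]
  {HC : Type*} [TopologicalSpace HC] {JC : ModelWithCorners ℝ EC HC}
  {C : Type*} [TopologicalSpace C] [ChartedSpace HC C]

theorem tangentA_le_tangentFst (p : (A × B) × C) :
    tangentA JA JB JC p ≤ tangentFst (JA.prod JB) JC p := by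
  intro v hv
  have hd : MDifferentiableAt ((JA.prod JB).prod JC) (JB.prod JC)
      (fun q : (A × B) × C ↦ (q.1.2, q.2)) p :=
    (mdifferentiableAt_snd.comp p mdifferentiableAt_fst).prodMk mdifferentiableAt_snd
  have := mfderiv_comp_apply (I'' := JC) (g := Prod.snd) p mdifferentiableAt_snd hd v
  rw [show mfderiv ((JA.prod JB).prod JC) (JB.prod JC)
    (fun q : (A × B) × C ↦ (q.1.2, q.2)) p v = 0 from hv, map_zero] at this
  exact this

theorem tangentB_le_tangentFst (p : (A × B) × C) :
    tangentB JA JB JC p ≤ tangentFst (JA.prod JB) JC p := by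
  intro v hv
  have hd : MDifferentiableAt ((JA.prod JB).prod JC) (JA.prod JC)
      (fun q : (A × B) × C ↦ (q.1.1, q.2)) p :=
    (mdifferentiableAt_fst.comp p mdifferentiableAt_fst).prodMk mdifferentiableAt_snd
  have := mfderiv_comp_apply (I'' := JC) (g := Prod.snd) p mdifferentiableAt_snd hd v
  rw [show mfderiv ((JA.prod JB).prod JC) (JA.prod JC)
    (fun q : (A × B) × C ↦ (q.1.1, q.2)) p v = 0 from hv, map_zero] at this
  exact this

variable [FiniteDimensional ℝ EA] [FiniteDimensional ℝ EB] [FiniteDimensional ℝ EC]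
  [IsManifold JA ∞ A] [IsManifold JB ∞ B] [IsManifold JC ∞ C]
  [JA.Boundaryless] [JB.Boundaryless] [JC.Boundaryless]
  {S : AlmostContactMetric I N} {cov : CovariantDerivative I E (TangentSpace I : N → Type _)}
  {ι : (A × B) × C → N}
  {g₂ : ContMDiffRiemannianMetric (JA.prod JB) ∞ (EA × EB)
      (fun x : A × B ↦ TangentSpace (JA.prod JB) x)}
  {gT : ContMDiffRiemannianMetric JC ∞ EC (fun x : C ↦ TangentSpace JC x)}
  {f : A × B → ℝ} {θ : ℝ}

theorem IsWarpedSkewCR.secondFF_mem_nu (h : IsWarpedSkewCR JA JB JC S ι g₂ gT f θ)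
    (hS : IsKenmotsu S cov) {p : (A × B) × C}
    {X Y : Π q : (A × B) × C, TangentSpace ((JA.prod JB).prod JC) q}
    (hY : MDifferentiableAt ((JA.prod JB).prod JC) ((JA.prod JB).prod JC).tangent
      (fun q ↦ (⟨q, Y q⟩ : TangentBundle ((JA.prod JB).prod JC) ((A × B) × C))) p)
    (hXp : X p ∈ tangentSnd (JA.prod JB) JC p) (hYp : Y p ∈ tangentFst (JA.prod JB) JC p) :
    secondFF ((JA.prod JB).prod JC) cov ι X Y p ∈ nu ((JA.prod JB).prod JC) S ι θ p := by
  have hι : ContMDiffAt ((JA.prod JB).prod JC) I ∞ ι p := h.warped.contMDiff_ι.contMDiffAt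
  have hφ (q) (z) (hz : z ∈ tangentSnd (JA.prod JB) JC q) :
      S.φ (ι q) (mfderiv ((JA.prod JB).prod JC) I ι q z) ∈ (tangentSnd (JA.prod JB) JC q).map
        (mfderiv ((JA.prod JB).prod JC) I ι q).toLinearMap := by
    rw [h.invariant q]
    refine φ_mem_distT ?_
    rw [← h.invariant q]
    exact ⟨z, hz, rfl⟩
  set D := covAlong ((JA.prod JB).prod JC) cov ι (fun q ↦ mfderiv ((JA.prod JB).prod JC) I ι q
    (FiberBundle.extend ((EA × EB) × EC) (X p) q)) p (Y p)
  have hsymm : secondFF ((JA.prod JB).prod JC) cov ι X Y p =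
      (normal I ((JA.prod JB).prod JC) ι p).starProjection D := by
    rw [secondFF_eq_extend hι X hY, secondFF,
      covAlong_mfderiv_extend_symm hS.isLeviCivita.torsion_free hι]
  have hQ {w : TangentSpace I (ι p)}
      (hw : w ∈ (tangentFst (JA.prod JB) JC p).map
        (mfderiv ((JA.prod JB).prod JC) I ι p).toLinearMap)
      (hPw : P ((JA.prod JB).prod JC) S ι p w ∈ (tangentFst (JA.prod JB) JC p).map
        (mfderiv ((JA.prod JB).prod JC) I ι p).toLinearMap) :
      ⟪Q ((JA.prod JB).prod JC) S ι p w,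
        secondFF ((JA.prod JB).prod JC) cov ι X Y p⟫_ℝ = 0 := by
    obtain ⟨a, ha, rfl⟩ := hw
    obtain ⟨b, hb, hbP⟩ := hPw
    have h1 : ⟪D, S.φ (ι p) (mfderiv ((JA.prod JB).prod JC) I ι p a)⟫_ℝ = 0 :=
      h.warped.inner_covAlong_φ hS (h.ξ_tangent p) hφ hYp ha hXp
    have h2 : ⟪D, mfderiv ((JA.prod JB).prod JC) I ι p b⟫_ℝ = 0 :=
      h.warped.inner_covAlong_tangentFst hS.isLeviCivita hYp hb
        (h.warped.diffAlongAt_mfderiv_extend (X p))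
        ((extend_mem_tangentSnd hXp).mono fun q hq ↦ ⟨_, hq, rfl⟩)
    rw [hsymm, ← Submodule.inner_starProjection_left_eq_right,
      starProjection_normal_Q, real_inner_comm]
    have h3 := P_add_Q (J := (JA.prod JB).prod JC) (S := S) (ι := ι) (p := p)
      (mfderiv ((JA.prod JB).prod JC) I ι p a)
    have h4 : ⟪D, P ((JA.prod JB).prod JC) S ι p
        (mfderiv ((JA.prod JB).prod JC) I ι p a)⟫_ℝ = 0 := by
      refine Eq.trans ?_ h2
      exact congrArg (fun z ↦ ⟪D, z⟫_ℝ) hbP.symm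
    rw [← h3, inner_add_right, h4, zero_add] at h1
    exact h1
  have hA := (h.le_antiInvariant p).trans (Submodule.map_mono (tangentA_le_tangentFst p))
  have hB := (h.le_slant p).trans (Submodule.map_mono (tangentB_le_tangentFst p))
  refine mem_nu.2 ⟨Submodule.starProjection_apply_mem _ _, fun w hw ↦ ?_, fun w hw ↦ ?_⟩
  · rw [← Q_eq_φ_of_mem_distPerp hw]
    refine hQ (hA hw) ?_
    rw [P_eq_zero_of_mem_distPerp hw]
    exact zero_mem _
  · exact hQ (hB hw) (hB (P_mem_eigenDist hw))

end Main

end SkewCR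

end

theorem proposition4p1 {m d₁ d₂ d₃ : ℕ}
    {N : Type*} [TopologicalSpace N] [ChartedSpace (EuclideanSpace ℝ (Fin (2 * m + 1))) N]
    [IsManifold (𝓡 (2 * m + 1)) ∞ N]
    [RiemannianBundle (fun x : N ↦ TangentSpace (𝓡 (2 * m + 1)) x)]
    [IsContMDiffRiemannianBundle (𝓡 (2 * m + 1)) ∞ (EuclideanSpace ℝ (Fin (2 * m + 1)))
      (fun x : N ↦ TangentSpace (𝓡 (2 * m + 1)) x)]
    {Mperp : Type*} [TopologicalSpace Mperp] [ChartedSpace (EuclideanSpace ℝ (Fin d₁)) Mperp]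
    [IsManifold (𝓡 d₁) ∞ Mperp]
    {Mθ : Type*} [TopologicalSpace Mθ] [ChartedSpace (EuclideanSpace ℝ (Fin d₂)) Mθ]
    [IsManifold (𝓡 d₂) ∞ Mθ]
    {MT : Type*} [TopologicalSpace MT] [ChartedSpace (EuclideanSpace ℝ (Fin d₃)) MT]
    [IsManifold (𝓡 d₃) ∞ MT]
    (S : SkewCR.AlmostContactMetric (𝓡 (2 * m + 1)) N)
    (cov : CovariantDerivative (𝓡 (2 * m + 1)) (EuclideanSpace ℝ (Fin (2 * m + 1)))
      (TangentSpace (𝓡 (2 * m + 1)) : N → Type _))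
    (hS : SkewCR.IsKenmotsu S cov)
    (ι : (Mperp × Mθ) × MT → N)
    (g₂ : ContMDiffRiemannianMetric ((𝓡 d₁).prod (𝓡 d₂)) ∞
      (EuclideanSpace ℝ (Fin d₁) × EuclideanSpace ℝ (Fin d₂))
      (fun x : Mperp × Mθ ↦ TangentSpace ((𝓡 d₁).prod (𝓡 d₂)) x))
    (gT : ContMDiffRiemannianMetric (𝓡 d₃) ∞ (EuclideanSpace ℝ (Fin d₃))
      (fun x : MT ↦ TangentSpace (𝓡 d₃) x))
    (f : Mperp × Mθ → ℝ) (θ : ℝ)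
    (hι : SkewCR.IsWarpedSkewCR (𝓡 d₁) (𝓡 d₂) (𝓡 d₃) S ι g₂ gT f θ)
    (p : (Mperp × Mθ) × MT) :
    (∀ v ∈ SkewCR.nu (((𝓡 d₁).prod (𝓡 d₂)).prod (𝓡 d₃)) S ι θ p,
      S.φ (ι p) v ∈ SkewCR.nu (((𝓡 d₁).prod (𝓡 d₂)).prod (𝓡 d₃)) S ι θ p) ∧
    ∀ X Y : Π q : (Mperp × Mθ) × MT, TangentSpace (((𝓡 d₁).prod (𝓡 d₂)).prod (𝓡 d₃)) q,
      ContMDiffAt (((𝓡 d₁).prod (𝓡 d₂)).prod (𝓡 d₃)) (((𝓡 d₁).prod (𝓡 d₂)).prod (𝓡 d₃)).tangent ∞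
        (fun q ↦ (⟨q, X q⟩ : TangentBundle (((𝓡 d₁).prod (𝓡 d₂)).prod (𝓡 d₃))
          ((Mperp × Mθ) × MT))) p →
      ContMDiffAt (((𝓡 d₁).prod (𝓡 d₂)).prod (𝓡 d₃)) (((𝓡 d₁).prod (𝓡 d₂)).prod (𝓡 d₃)).tangent ∞
        (fun q ↦ (⟨q, Y q⟩ : TangentBundle (((𝓡 d₁).prod (𝓡 d₂)).prod (𝓡 d₃))
          ((Mperp × Mθ) × MT))) p →
      X p ∈ SkewCR.tangentSnd ((𝓡 d₁).prod (𝓡 d₂)) (𝓡 d₃) p →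
      Y p ∈ SkewCR.tangentFst ((𝓡 d₁).prod (𝓡 d₂)) (𝓡 d₃) p →
      SkewCR.secondFF (((𝓡 d₁).prod (𝓡 d₂)).prod (𝓡 d₃)) cov ι X Y p
        ∈ SkewCR.nu (((𝓡 d₁).prod (𝓡 d₂)).prod (𝓡 d₃)) S ι θ p :=
  ⟨fun _ hv ↦ hι.skewCR.φ_mem_nu hv, fun _ _ _ hY hXp hYp ↦
    hι.secondFF_mem_nu hS (hY.mdifferentiableAt (by simp)) hXp hYp⟩
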